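/- Let $m\ge 4$ and let $$F_{m,1}=\{\Delta+\Gamma\Gamma^t : \Delta\in\mathbb{R}^{m\times m}\text{ diagonal and positive definite},\ \Gamma\in\mathbb{R}^{m}\}$$ be the set of covariance matrices of the one-factor analysis model. Identify the space of symmetric $m\times m$ matrices with $\mathbb{R}^{\binom{m+1}{2}}$ through the entries with index $ij$, $i\le j$, and let $I(\Sigma)$ be the Fisher information matrix at $\Sigma$, in these coordinates, of the model of all centered normal distributions $\mathcal{N}_m(0,\Sigma)$ with $\Sigma$ positive definite. For a set $\Theta\subseteq\mathbb{R}^k$ and $\theta\in\Theta$, the algebraic tangent cone is $$A_\Theta(\theta)=\{\tau\in\mathbb{R}^k : f_{\theta,\min}(\tau)=0\text{ for all } f\in\mathbb{R}[t_1,\dots,t_k]\text{ that vanish on }\Theta\},$$ where $f_{\theta,\min}$ is the nonzero homogeneous component of smallest degree of the polynomial $f_\theta(t)=f(t+\theta)$ (and $f_{\theta,\min}=0$ if $f=0$). **Theorem 6.3.** Let $\Sigma_0=(\sigma_{gh})\in F_{m,1}$ have exactly one nonzero off-diagonal entry $\sigma_{ij}$ with $i<j$, and let $Z\sim\mathcal{N}_{\binom{m+1}{2}}(0,I(\Sigma_0)^{-1})$.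 Then the squared Mahalanobis distance $$\min_{\Sigma\in A_{F_{m,1}}(\Sigma_0)}(Z-\Sigma)^t I(\Sigma_0)(Z-\Sigma),$$ in which the minimum is attained, has the distribution of $V+W$, where $V$ and $W$ are independent, $V$ has the chi-square distribution with $\binom{m-2}{2}$ degrees of freedom, and $W$ is distributed like the smaller of the two eigenvalues of a $2\times2$ Wishart matrix with $m-2$ degrees of freedom and scale parameter the identity matrix. -/

import Mathlib

open MeasureTheory ProbabilityTheory

noncomputable section

/-! ### Algebraic tangent cones -/

section AlgebraicTangentCone

variable {κ : Type*}

/-- The polynomial `f_θ`, obtained from `f` by substituting `t_i + θ_i` for each `t_i`. -/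
def shiftPoly (θ : κ → ℝ) (f : MvPolynomial κ ℝ) : MvPolynomial κ ℝ :=
  MvPolynomial.aeval (fun i => MvPolynomial.X i + MvPolynomial.C (θ i)) f

/-- The nonzero homogeneous component of smallest degree of `g` (and `0` if `g = 0`). -/
def initialForm (g : MvPolynomial κ ℝ) : MvPolynomial κ ℝ :=
  MvPolynomial.homogeneousComponent
    (sInf {h : ℕ | MvPolynomial.homogeneousComponent h g ≠ 0}) g

/-- The algebraic tangent cone of `Θ` at `θ`: the common zeros of the lowest-degree forms
of all `f_θ`, where `f` runs over all polynomials that vanish on `Θ`. -/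
def algebraicTangentCone (Θ : Set (κ → ℝ)) (θ : κ → ℝ) : Set (κ → ℝ) :=
  {τ | ∀ f ∈ MvPolynomial.vanishingIdeal ℝ Θ,
    MvPolynomial.eval τ (initialForm (shiftPoly θ f)) = 0}

end AlgebraicTangentCone

/-! ### Coordinates on the space of symmetric matrices -/

/-- Ordered pairs `ij` with `i ≤ j`. -/
abbrev SymIdx (m : ℕ) : Type := {p : Fin m × Fin m // p.1 ≤ p.2}

/-- The upper triangular entries of a (symmetric) matrix. -/
def symCoords {m : ℕ} (S : Matrix (Fin m) (Fin m) ℝ) : SymIdx m → ℝ :=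
  fun p => S p.1.1 p.1.2

/-- The symmetric matrix with the given upper triangular entries. -/
def symMatrix {m : ℕ} (θ : SymIdx m → ℝ) : Matrix (Fin m) (Fin m) ℝ :=
  Matrix.of fun i j => θ ⟨(min i j, max i j), min_le_max⟩

/-! ### The factor analysis model -/

/-- The covariance matrices `Δ + Γ Γᵗ` with `Δ` a positive definite diagonal matrix and `Γ` a
real `m × l` matrix. -/
def factorModel (m l : ℕ) : Set (Matrix (Fin m) (Fin m) ℝ) :=
  {S | ∃ (δ : Fin m → ℝ) (Γ : Matrix (Fin m) (Fin l) ℝ),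
    (∀ i, 0 < δ i) ∧ S = Matrix.diagonal δ + Γ * Γ.transpose}

/-! ### Fisher information of the centered normal model -/

/-- The Lebesgue density of the normal distribution `N(0, S)`, for positive definite `S`. -/
def normalDensity {m : ℕ} (S : Matrix (Fin m) (Fin m) ℝ) (x : Fin m → ℝ) : ℝ :=
  (Real.sqrt ((2 * Real.pi) ^ m * S.det))⁻¹ *
    Real.exp (-(dotProduct x (S⁻¹.mulVec x)) / 2)

/-- The score: the partial derivative, with respect to the coordinate `a`, of the log-density of
`N(0, S)`, where `S` is parametrized by its upper triangular entries. -/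
def normalScore {m : ℕ} (S : Matrix (Fin m) (Fin m) ℝ) (a : SymIdx m) (x : Fin m → ℝ) : ℝ :=
  deriv (fun t : ℝ =>
    Real.log (normalDensity (symMatrix (symCoords S + t • Pi.single a (1 : ℝ))) x)) 0

/-- The Fisher information matrix at `S` of the model of all centered normal distributions:
the expected outer product of the score under `N(0, S)`. -/
def fisherInformation {m : ℕ} (S : Matrix (Fin m) (Fin m) ℝ) :
    Matrix (SymIdx m) (SymIdx m) ℝ :=
  Matrix.of fun a b =>
    ∫ x : EuclideanSpace ℝ (Fin m), normalScore S a x.ofLp * normalScore S b x.ofLp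
      ∂(multivariateGaussian 0 S)

/-! ### Mahalanobis distance -/

/-- The quadratic form `(z - τ)ᵗ J (z - τ)`. -/
def mahalanobisForm {κ : Type*} [Fintype κ] (J : Matrix κ κ ℝ) (z τ : κ → ℝ) : ℝ :=
  dotProduct (z - τ) (J.mulVec (z - τ))

/-- The squared Mahalanobis distance from `z` to the set `A`. -/
def mahalanobisDistSq {κ : Type*} [Fintype κ] (J : Matrix κ κ ℝ) (A : Set (κ → ℝ))
    (z : κ → ℝ) : ℝ :=
  sInf (mahalanobisForm J z '' A)

/-! ### Chi-square and Wishart distributions -/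

/-- The chi-square distribution with `k` degrees of freedom: the law of the sum of squares of
`k` independent standard normal random variables. -/
def chiSquareLaw (k : ℕ) : Measure ℝ :=
  (Measure.pi fun _ : Fin k => gaussianReal 0 1).map fun x => ∑ i, x i ^ 2

instance matrixMeasurableSpace {ι κ : Type*} : MeasurableSpace (Matrix ι κ ℝ) :=
  inferInstanceAs (MeasurableSpace (ι → κ → ℝ))

/-- The `p × p` Wishart distribution with `n` degrees of freedom and scale parameter `S`: the law
of `∑ xₖ xₖᵗ` for independent `x₁, …, xₙ` with distribution `N(0, S)`. -/
def wishartLaw (p n : ℕ) (S : Matrix (Fin p) (Fin p) ℝ) : Measure (Matrix (Fin p) (Fin p) ℝ) :=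
  (Measure.pi fun _ : Fin n => multivariateGaussian (0 : EuclideanSpace ℝ (Fin p)) S).map
    fun x => ∑ k, Matrix.vecMulVec (x k).ofLp (x k).ofLp

/-- The smallest eigenvalue of a (symmetric) real matrix. -/
def smallestEigenvalue {p : ℕ} (M : Matrix (Fin p) (Fin p) ℝ) : ℝ :=
  sInf {c : ℝ | Module.End.HasEigenvalue (Matrix.toLin' M) c}

end

/-!
At a matrix `Σ₀` whose only nonzero off-diagonal entry is `σ_ij`, the initial forms of the shifted
tetrads are, up to the factor `σ_ij`, the entry `τ_kl` and the minor `τ_ik τ_jl - τ_il τ_jk` with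
`k, l ∉ {i, j}`. Their common zeros exhaust the tangent cone: a rank one block
`(τ_ik, τ_jk)_k = (a u, b u)` with `a b ≠ 0` is the derivative at `Σ₀` of a curve in the model, and
the remaining zeros are limits of such blocks.

The Fisher information of the normal model is `⟨X, Y⟩ = tr(Σ₀⁻¹ X Σ₀⁻¹ Y) / 2`, so for
`L = Σ₀^(-1/2)` the map `X ↦ L X Lᵗ` turns the Mahalanobis form into a sum of squares and `Z` into
a standard normal vector. Since `L` is block diagonal like `Σ₀`, it preserves the equations of the
cone. The squared distance is then a sum of `(m-2).choose 2` squares plus the squared distance of an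
`(m - 2) × 2` Gaussian matrix `Y` to the matrices of rank at most one, which is the smaller
eigenvalue of `YᵗY`.
-/

open Filter Topology
open scoped Matrix MatrixOrder

section InitialForms

variable {κ : Type*}

theorem eval_shiftPoly (θ τ : κ → ℝ) (f : MvPolynomial κ ℝ) :
    MvPolynomial.eval τ (shiftPoly θ f) = MvPolynomial.eval (τ + θ) f := by
  rw [shiftPoly, MvPolynomial.map_aeval]
  simp only [map_add, MvPolynomial.eval_X, MvPolynomial.eval_C, MvPolynomial.coe_eval₂Hom]
  congr 1
  ext r
  simp

theorem initialForm_eq_of_homogeneousComponent {g h : MvPolynomial κ ℝ} {n : ℕ}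
    (hn : MvPolynomial.homogeneousComponent n g = h) (h0 : h ≠ 0)
    (hlt : ∀ k < n, MvPolynomial.homogeneousComponent k g = 0) : initialForm g = h := by
  have hmin : IsLeast {k : ℕ | MvPolynomial.homogeneousComponent k g ≠ 0} n :=
    ⟨hn.trans_ne h0, fun k hk => not_lt.mp fun hkn => hk (hlt k hkn)⟩
  rw [initialForm, hmin.csInf_eq, hn]

theorem initialForm_add_of_isHomogeneous {h r : MvPolynomial κ ℝ} {n k : ℕ}
    (hh : h.IsHomogeneous n) (hr : r.IsHomogeneous k) (hnk : n < k) (h0 : h ≠ 0) :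
    initialForm (h + r) = h := by
  have component (l : ℕ) : MvPolynomial.homogeneousComponent l (h + r)
      = (if l = n then h else 0) + if l = k then r else 0 := by
    rw [map_add, MvPolynomial.homogeneousComponent_of_mem hh,
      MvPolynomial.homogeneousComponent_of_mem hr]
  refine initialForm_eq_of_homogeneousComponent (n := n) ?_ h0 fun l hl => ?_
  · rw [component, if_pos rfl, if_neg hnk.ne, add_zero]
  · rw [component, if_neg hl.ne, if_neg (hl.trans hnk).ne, add_zero]

theorem initialForm_of_isHomogeneous {h : MvPolynomial κ ℝ} {n : ℕ}
    (hh : h.IsHomogeneous n) (h0 : h ≠ 0) : initialForm h = h := by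
  simpa using initialForm_add_of_isHomogeneous hh
    (MvPolynomial.isHomogeneous_zero κ ℝ (n + 1)) n.lt_succ_self h0

theorem eval_smul_of_isHomogeneous {h : MvPolynomial κ ℝ} {n : ℕ} (hh : h.IsHomogeneous n)
    (t : ℝ) (w : κ → ℝ) :
    MvPolynomial.eval (t • w) h = t ^ n * MvPolynomial.eval w h := by
  rw [MvPolynomial.eval_eq, MvPolynomial.eval_eq, Finset.mul_sum]
  refine Finset.sum_congr rfl fun d hd => ?_
  simp only [Pi.smul_apply, smul_eq_mul, mul_pow, Finset.prod_mul_distrib]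
  rw [Finset.prod_pow_eq_pow_sum, ← hh.degree_eq_sum_deg_support hd]
  ring

theorem exists_eval_smul_eq_pow_mul_initialForm_add (g : MvPolynomial κ ℝ) :
    ∃ (d : ℕ) (R : ℝ × (κ → ℝ) → ℝ), Continuous R ∧ ∀ t w,
      MvPolynomial.eval (t • w) g
        = t ^ d * (MvPolynomial.eval w (initialForm g) + t * R (t, w)) := by
  set d := sInf {k : ℕ | MvPolynomial.homogeneousComponent k g ≠ 0} with hd
  have hlt (k : ℕ) (hk : k < d) : MvPolynomial.homogeneousComponent k g = 0 :=
    not_not.mp (Nat.notMem_of_lt_sInf hk)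
  refine ⟨d, fun q => ∑ k ∈ Finset.range (g.totalDegree + 1), if d < k then
    q.1 ^ (k - d - 1) * MvPolynomial.eval q.2 (MvPolynomial.homogeneousComponent k g) else 0,
    ?_, fun t w => ?_⟩
  · refine continuous_finsetSum _ fun k _ => ?_
    split_ifs
    · exact (continuous_fst.pow _).mul ((MvPolynomial.continuous_eval _).comp continuous_snd)
    · exact continuous_const
  · have hinit : MvPolynomial.eval w (initialForm g) = ∑ k ∈ Finset.range (g.totalDegree + 1),
        if k = d then MvPolynomial.eval w (MvPolynomial.homogeneousComponent k g) else 0 := by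
      rw [Finset.sum_ite_eq', initialForm, ← hd]
      split_ifs with hmem
      · rfl
      · rw [MvPolynomial.homogeneousComponent_eq_zero _ _ (by simpa using hmem), map_zero]
    rw [hinit, Finset.mul_sum, ← Finset.sum_add_distrib, Finset.mul_sum]
    conv_lhs => rw [← MvPolynomial.sum_homogeneousComponent g, map_sum]
    refine Finset.sum_congr rfl fun k _ => ?_
    rw [eval_smul_of_isHomogeneous (MvPolynomial.homogeneousComponent_isHomogeneous k g)]
    rcases lt_trichotomy k d with hk | rfl | hk
    · simp [hlt k hk]
    · simp
    · obtain ⟨e, rfl⟩ := Nat.exists_eq_add_of_lt hk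
      rw [if_neg hk.ne', if_pos hk, show d + e + 1 - d - 1 = e by omega]
      ring

theorem eval_initialForm_eq_zero_of_tendsto {g : MvPolynomial κ ℝ} {τ : κ → ℝ} {w : ℝ → κ → ℝ}
    (hw : Tendsto w (𝓝[>] 0) (𝓝 τ))
    (hg : ∀ᶠ t in 𝓝[>] (0 : ℝ), MvPolynomial.eval (t • w t) g = 0) :
    MvPolynomial.eval τ (initialForm g) = 0 := by
  obtain ⟨d, R, hR, hexp⟩ := exists_eval_smul_eq_pow_mul_initialForm_add g
  have hzero : ∀ᶠ t in 𝓝[>] (0 : ℝ),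
      0 = MvPolynomial.eval (w t) (initialForm g) + t * R (t, w t) := by
    filter_upwards [hg, self_mem_nhdsWithin] with t ht htpos
    rw [hexp] at ht
    exact ((mul_eq_zero.mp ht).resolve_left (pow_pos htpos d).ne').symm
  have hid : Tendsto (fun t : ℝ => t) (𝓝[>] 0) (𝓝 0) := nhdsWithin_le_nhds
  have hlim : Tendsto (fun t => MvPolynomial.eval (w t) (initialForm g) + t * R (t, w t))
      (𝓝[>] 0) (𝓝 (MvPolynomial.eval τ (initialForm g) + 0 * R (0, τ))) :=
    (((MvPolynomial.continuous_eval _).tendsto τ).comp hw).add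
      (hid.mul ((hR.tendsto (0, τ)).comp (hid.prodMk_nhds hw)))
  simpa using tendsto_nhds_unique (hlim.congr' (hzero.mono fun _ h => h.symm)) tendsto_const_nhds

theorem mem_algebraicTangentCone_of_tendsto {Θ : Set (κ → ℝ)} {θ τ : κ → ℝ} {w : ℝ → κ → ℝ}
    (hw : Tendsto w (𝓝[>] 0) (𝓝 τ))
    (hz : ∀ f ∈ MvPolynomial.vanishingIdeal ℝ Θ, ∀ᶠ t in 𝓝[>] (0 : ℝ),
      MvPolynomial.eval (t • w t + θ) f = 0) :
    τ ∈ algebraicTangentCone Θ θ := by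
  intro f hf
  refine eval_initialForm_eq_zero_of_tendsto hw ?_
  filter_upwards [hz f hf] with t ht
  rw [eval_shiftPoly, ht]

theorem isClosed_algebraicTangentCone (Θ : Set (κ → ℝ)) (θ : κ → ℝ) :
    IsClosed (algebraicTangentCone Θ θ) := by
  simp only [algebraicTangentCone, Set.ofPred_forall]
  exact isClosed_biInter fun f _ =>
    isClosed_eq (MvPolynomial.continuous_eval _) continuous_const

theorem eval_eq_zero_of_eventually_eval_add_smul {f : MvPolynomial κ ℝ} {θ η : κ → ℝ}
    (h : ∀ᶠ r : ℝ in atTop, MvPolynomial.eval (θ + r • η) f = 0) :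
    MvPolynomial.eval θ f = 0 := by
  let q : Polynomial ℝ := MvPolynomial.aeval
    (fun k => Polynomial.C (θ k) + Polynomial.X * Polynomial.C (η k)) f
  have hq (r : ℝ) : q.eval r = MvPolynomial.eval (θ + r • η) f := by
    rw [← Polynomial.coe_evalRingHom, MvPolynomial.map_aeval, MvPolynomial.coe_eval₂Hom]
    simp only [map_add, map_mul, Polynomial.coe_evalRingHom, Polynomial.eval_C,
      Polynomial.eval_X]
    congr 1
    ext
    simp
  have hq0 : q = 0 := by
    obtain ⟨R, hR⟩ := eventually_atTop.mp h
    exact Polynomial.eq_zero_of_infinite_isRoot q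
      ((Set.Ici_infinite R).mono fun r hr => (hq r).trans (hR r hr))
  simpa [hq0] using (hq 0).symm

end InitialForms

/-! ### Equations of the tangent cone -/

section SymmetricCoordinates

variable {m : ℕ}

/-- The index of the entry `a b` (equivalently `b a`) of a symmetric matrix. -/
def symIdx (a b : Fin m) : SymIdx m := ⟨(min a b, max a b), min_le_max⟩

theorem symMatrix_apply (θ : SymIdx m → ℝ) (a b : Fin m) : symMatrix θ a b = θ (symIdx a b) := rfl

theorem symMatrix_add (θ η : SymIdx m → ℝ) : symMatrix (θ + η) = symMatrix θ + symMatrix η := rfl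

theorem symMatrix_smul (c : ℝ) (θ : SymIdx m → ℝ) : symMatrix (c • θ) = c • symMatrix θ := rfl

theorem symIdx_comm (a b : Fin m) : symIdx a b = symIdx b a := by
  simp only [symIdx, min_comm, max_comm]

theorem symIdx_of_le {a b : Fin m} (h : a ≤ b) : symIdx a b = ⟨(a, b), h⟩ := by
  simp [symIdx, h]

theorem symIdx_eq_iff {a b c d : Fin m} :
    symIdx a b = symIdx c d ↔ (a = c ∧ b = d) ∨ (a = d ∧ b = c) := by
  constructor
  · intro h
    have hmin : min a b = min c d := congrArg (fun p => p.1.1) h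
    have hmax : max a b = max c d := congrArg (fun p => p.1.2) h
    rcases le_total a b with hab | hab <;> rcases le_total c d with hcd | hcd <;> simp_all
  · rintro (⟨rfl, rfl⟩ | ⟨rfl, rfl⟩)
    · rfl
    · exact symIdx_comm _ _

theorem symMatrix_isSymm (θ : SymIdx m → ℝ) : (symMatrix θ).IsSymm := by
  ext a b
  rw [Matrix.transpose_apply, symMatrix_apply, symMatrix_apply, symIdx_comm]

theorem symCoords_symIdx {S : Matrix (Fin m) (Fin m) ℝ} (hS : S.IsSymm) (a b : Fin m) :
    symCoords S (symIdx a b) = S a b := by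
  rcases le_total a b with h | h
  · rw [symIdx_of_le h]; rfl
  · rw [symIdx_comm, symIdx_of_le h]; exact hS.apply a b

theorem symMatrix_symCoords {S : Matrix (Fin m) (Fin m) ℝ} (hS : S.IsSymm) :
    symMatrix (symCoords S) = S := by
  ext a b
  rw [symMatrix_apply, symCoords_symIdx hS]

theorem symCoords_symMatrix (θ : SymIdx m → ℝ) : symCoords (symMatrix θ) = θ :=
  funext fun p => congrArg θ (symIdx_of_le p.2)

end SymmetricCoordinates

section TangentEquations

variable {n : Type*}

/-- The indices other than `i` and `j`. -/
abbrev Others (i j : n) : Type _ := {k : n // k ≠ i ∧ k ≠ j}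

/-- The equations, in terms of the entries of a symmetric matrix, of the tangent cone of the
one-factor model at a matrix whose only nonzero off-diagonal entries are those at `i j` and
`j i`. -/
structure TangentEquations (i j : n) (X : Matrix n n ℝ) : Prop where
  apply_eq_zero (k l : Others i j) : k ≠ l → X k l = 0
  minor_eq (k l : Others i j) : X i k * X j l = X i l * X j k

/-- Block diagonal matrices with one block on `{i, j}` and all other blocks of size one. -/
def IsPairDiagonal [Fintype n] [DecidableEq n] (i j : n) (M : Matrix n n ℝ) : Prop :=
  ∀ k : Others i j, Commute (Matrix.single k.1 k.1 1) M

variable {i j : n}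

theorem forall_ne_of_forall_others {p : n → n → Prop} (hsymm : ∀ a b, p a b → p b a)
    (hij : p i j) (hi : ∀ k : Others i j, p i k) (hj : ∀ k : Others i j, p j k)
    (hoff : ∀ k l : Others i j, k ≠ l → p k l) (a b : n) (hab : a ≠ b) : p a b := by
  have hpair (c : n) (hci : c ≠ i) (hcj : c ≠ j) : p c i ∧ p c j :=
    ⟨hsymm _ _ (hi ⟨c, hci, hcj⟩), hsymm _ _ (hj ⟨c, hci, hcj⟩)⟩
  by_cases hai : a = i <;> by_cases haj : a = j <;> by_cases hbi : b = i <;> by_cases hbj : b = j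
  all_goals first
    | exact hoff ⟨a, hai, haj⟩ ⟨b, hbi, hbj⟩ fun h => hab (congrArg Subtype.val h)
    | grind

variable [Fintype n] [DecidableEq n]

theorem isPairDiagonal_iff {M : Matrix n n ℝ} :
    IsPairDiagonal i j M ↔ ∀ (k : Others i j) (a : n), a ≠ k → M k a = 0 ∧ M a k = 0 := by
  refine ⟨fun h k a ha => ⟨Matrix.row_eq_zero_of_commute_single (h k) ha,
    Matrix.col_eq_zero_of_commute_single (h k) ha⟩, fun h k => ?_⟩
  ext a b
  rcases eq_or_ne a k with rfl | ha <;> rcases eq_or_ne b k with rfl | hb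
  · simp
  · simp [(h k b hb).1, hb]
  · simp [(h k a ha).2, ha]
  · simp [ha, hb]

theorem IsPairDiagonal.row_eq_zero {M : Matrix n n ℝ} (hM : IsPairDiagonal i j M)
    (k : Others i j) {a : n} (ha : a ≠ k) : M k a = 0 :=
  (isPairDiagonal_iff.mp hM k a ha).1

theorem IsPairDiagonal.col_eq_zero {M : Matrix n n ℝ} (hM : IsPairDiagonal i j M)
    (k : Others i j) {a : n} (ha : a ≠ k) : M a k = 0 :=
  (isPairDiagonal_iff.mp hM k a ha).2

theorem IsPairDiagonal.mul_apply_others {M : Matrix n n ℝ} (hM : IsPairDiagonal i j M)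
    (X : Matrix n n ℝ) (k : Others i j) (b : n) : (M * X) k b = M k k * X k b := by
  rw [Matrix.mul_apply, Fintype.sum_eq_single k.1 fun a ha => by rw [hM.row_eq_zero k ha, zero_mul]]

theorem IsPairDiagonal.mul_transpose_apply_others {M : Matrix n n ℝ} (hM : IsPairDiagonal i j M)
    (X : Matrix n n ℝ) (a : n) (k : Others i j) : (X * Mᵀ) a k = X a k * M k k := by
  rw [Matrix.mul_apply, Fintype.sum_eq_single k.1 fun b hb => by
    rw [Matrix.transpose_apply, hM.row_eq_zero k hb, mul_zero], Matrix.transpose_apply]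

theorem IsPairDiagonal.mul_apply_pair {M : Matrix n n ℝ} (hM : IsPairDiagonal i j M) (hij : i ≠ j)
    (X : Matrix n n ℝ) {a : n} (ha : a = i ∨ a = j) (b : n) :
    (M * X) a b = M a i * X i b + M a j * X j b := by
  have hzero (k : n) (hk : k ≠ i ∧ k ≠ j) : M a k * X k b = 0 := by
    rw [hM.col_eq_zero ⟨k, hk⟩ (by grind), zero_mul]
  rw [Matrix.mul_apply, Fintype.sum_eq_add i j hij hzero]

theorem TangentEquations.mul_mul_transpose {L X : Matrix n n ℝ} (hX : TangentEquations i j X)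
    (hL : IsPairDiagonal i j L) (hij : i ≠ j) : TangentEquations i j (L * X * Lᵀ) where
  apply_eq_zero k l hkl := by
    rw [hL.mul_transpose_apply_others, hL.mul_apply_others, hX.apply_eq_zero k l hkl, mul_zero,
      zero_mul]
  minor_eq k l := by
    simp only [hL.mul_transpose_apply_others, hL.mul_apply_pair hij X (.inl rfl),
      hL.mul_apply_pair hij X (.inr rfl)]
    linear_combination
      L k k * L l l * (L i i * L j j - L i j * L j i) * hX.minor_eq k l

theorem tangentEquations_mul_mul_transpose_iff {L M X : Matrix n n ℝ} (hij : i ≠ j)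
    (hML : M * L = 1) (hL : IsPairDiagonal i j L) (hM : IsPairDiagonal i j M) :
    TangentEquations i j (L * X * Lᵀ) ↔ TangentEquations i j X := by
  refine ⟨fun h => ?_, fun h => h.mul_mul_transpose hL hij⟩
  have hX : M * (L * X * Lᵀ) * Mᵀ = X := by
    rw [← Matrix.mul_assoc, ← Matrix.mul_assoc, hML, Matrix.one_mul, Matrix.mul_assoc,
      ← Matrix.transpose_mul, hML, Matrix.transpose_one, Matrix.mul_one]
  exact hX ▸ h.mul_mul_transpose hM hij

end TangentEquations

theorem exists_eq_smul_of_minors_eq {ι 𝕜 : Type*} [Field 𝕜] {x y : ι → 𝕜}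
    (h : ∀ k l, x k * y l = x l * y k) :
    ∃ (a b : 𝕜) (u : ι → 𝕜), (a ≠ 0 ∨ b ≠ 0) ∧ x = a • u ∧ y = b • u := by
  by_cases hx : x = 0
  · exact ⟨0, 1, y, .inr one_ne_zero, by simp [hx], by simp⟩
  obtain ⟨k, hk⟩ := Function.ne_iff.mp hx
  refine ⟨1, y k / x k, x, .inl one_ne_zero, by simp, funext fun l => ?_⟩
  rw [Pi.smul_apply, smul_eq_mul, div_mul_eq_mul_div, eq_div_iff hk]
  linear_combination h k l

section FactorModel

variable {m : ℕ}

theorem isSymm_of_mem_factorModel {l : ℕ} {S : Matrix (Fin m) (Fin m) ℝ}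
    (hS : S ∈ factorModel m l) : S.IsSymm := by
  obtain ⟨δ, Γ, -, rfl⟩ := hS
  exact (Matrix.isSymm_diagonal δ).add
    (by rw [Matrix.IsSymm, Matrix.transpose_mul, Matrix.transpose_transpose])

theorem posDef_of_mem_factorModel {l : ℕ} {S : Matrix (Fin m) (Fin m) ℝ}
    (hS : S ∈ factorModel m l) : S.PosDef := by
  obtain ⟨δ, Γ, hδ, rfl⟩ := hS
  exact (Matrix.PosDef.diagonal hδ).add_posSemidef
    (by simpa using Matrix.posSemidef_self_mul_conjTranspose Γ)

theorem exists_apply_eq_mul_of_mem_factorModel_one {S : Matrix (Fin m) (Fin m) ℝ}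
    (hS : S ∈ factorModel m 1) : ∃ γ : Fin m → ℝ, ∀ a b, a ≠ b → S a b = γ a * γ b := by
  obtain ⟨δ, Γ, -, rfl⟩ := hS
  refine ⟨fun a => Γ a 0, fun a b hab => ?_⟩
  simp [Matrix.diagonal_apply_ne _ hab, Matrix.mul_apply]

theorem mem_factorModel_one_of_apply_eq {S : Matrix (Fin m) (Fin m) ℝ} {γ : Fin m → ℝ} {p : ℝ}
    (hp : 0 ≤ p) (hoff : ∀ a b, a ≠ b → S a b = p * (γ a * γ b))
    (hdiag : ∀ a, p * γ a ^ 2 < S a a) : S ∈ factorModel m 1 := by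
  refine ⟨fun a => S a a - p * γ a ^ 2, Matrix.of fun a _ => √p * γ a,
    fun a => sub_pos.mpr (hdiag a), ?_⟩
  ext a b
  have hgram : √p * γ a * (√p * γ b) = p * (γ a * γ b) := by
    linear_combination γ a * γ b * Real.mul_self_sqrt hp
  rcases eq_or_ne a b with rfl | hab
  · simp [Matrix.mul_apply, hgram, pow_two]
  · simp [Matrix.mul_apply, hgram, hoff a b hab, hab]

/-- The Zariski closure of the model drops the sign conditions: increasing `p` and the diagonal
entries along a line leads into the model. -/
theorem eval_symCoords_eq_zero_of_apply_eq {f : MvPolynomial (SymIdx m) ℝ}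
    (hf : f ∈ MvPolynomial.vanishingIdeal ℝ (symCoords '' factorModel m 1))
    {M : Matrix (Fin m) (Fin m) ℝ} {γ : Fin m → ℝ} {p : ℝ}
    (hM : ∀ a b, a ≠ b → M a b = p * (γ a * γ b)) :
    MvPolynomial.eval (symCoords M) f = 0 := by
  refine eval_eq_zero_of_eventually_eval_add_smul
    (η := symCoords (1 + Matrix.vecMulVec γ γ)) ?_
  have hdiag : ∀ᶠ r : ℝ in atTop, ∀ a, p * γ a ^ 2 - M a a < r :=
    eventually_all.mpr fun a => eventually_gt_atTop _
  filter_upwards [hdiag, eventually_ge_atTop (-p)] with r hr hp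
  have hmem : M + r • (1 + Matrix.vecMulVec γ γ) ∈ factorModel m 1 := by
    refine mem_factorModel_one_of_apply_eq (γ := γ) (p := p + r) (by linarith)
      (fun a b hab => ?_) fun a => ?_
    · simp [Matrix.vecMulVec_apply, hM a b hab, hab, add_mul]
    · simp only [Matrix.add_apply, Matrix.smul_apply, Matrix.one_apply_eq,
        Matrix.vecMulVec_apply, smul_eq_mul]
      linarith [hr a]
  exact MvPolynomial.mem_vanishingIdeal_iff.mp hf _ ⟨_, hmem, rfl⟩

end FactorModel

section Tetrads

variable {m : ℕ}

/-- The tetrad `σ_ij σ_kl - σ_ik σ_jl`. -/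
noncomputable def tetrad (i j k l : Fin m) : MvPolynomial (SymIdx m) ℝ :=
  MvPolynomial.X (symIdx i j) * MvPolynomial.X (symIdx k l)
    - MvPolynomial.X (symIdx i k) * MvPolynomial.X (symIdx j l)

theorem tetrad_mem_vanishingIdeal {i j k l : Fin m} (hij : i ≠ j) (hkl : k ≠ l) (hik : i ≠ k)
    (hjl : j ≠ l) :
    tetrad i j k l ∈ MvPolynomial.vanishingIdeal ℝ (symCoords '' factorModel m 1) := by
  rw [MvPolynomial.mem_vanishingIdeal_iff]
  rintro _ ⟨S, hS, rfl⟩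
  obtain ⟨γ, hγ⟩ := exists_apply_eq_mul_of_mem_factorModel_one hS
  simp only [tetrad, map_sub, map_mul, MvPolynomial.aeval_X,
    symCoords_symIdx (isSymm_of_mem_factorModel hS), hγ _ _ hij, hγ _ _ hkl, hγ _ _ hik,
    hγ _ _ hjl]
  ring

theorem tetrad_isHomogeneous (i j k l : Fin m) : (tetrad i j k l).IsHomogeneous 2 :=
  ((MvPolynomial.isHomogeneous_X ℝ _).mul (MvPolynomial.isHomogeneous_X ℝ _)).sub
    ((MvPolynomial.isHomogeneous_X ℝ _).mul (MvPolynomial.isHomogeneous_X ℝ _))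

theorem eval_tetrad_symCoords {X : Matrix (Fin m) (Fin m) ℝ} (hX : X.IsSymm) (i j k l : Fin m) :
    MvPolynomial.eval (symCoords X) (tetrad i j k l) = X i j * X k l - X i k * X j l := by
  simp only [tetrad, map_sub, map_mul, MvPolynomial.eval_X, symCoords_symIdx hX]

theorem shiftPoly_tetrad {S : Matrix (Fin m) (Fin m) ℝ} (hS : S.IsSymm) (i j k l : Fin m) :
    shiftPoly (symCoords S) (tetrad i j k l) =
      (MvPolynomial.X (symIdx i j) + MvPolynomial.C (S i j)) *
        (MvPolynomial.X (symIdx k l) + MvPolynomial.C (S k l))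
      - (MvPolynomial.X (symIdx i k) + MvPolynomial.C (S i k)) *
        (MvPolynomial.X (symIdx j l) + MvPolynomial.C (S j l)) := by
  simp only [shiftPoly, tetrad, map_sub, map_mul, MvPolynomial.aeval_X, symCoords_symIdx hS]

variable {S X : Matrix (Fin m) (Fin m) ℝ}

theorem linear_term_eq_zero_of_mem_algebraicTangentCone {i j k l : Fin m} (hS : S.IsSymm)
    (hX : X.IsSymm)
    (hcone : symCoords X ∈ algebraicTangentCone (symCoords '' factorModel m 1) (symCoords S))
    (hij : i ≠ j) (hkl : k ≠ l) (hik : i ≠ k) (hjl : j ≠ l) (hSij : S i j ≠ 0)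
    (hSkl : S k l = 0) (hSik : S i k = 0) (hSjl : S j l = 0) : X k l = 0 := by
  have hshift : shiftPoly (symCoords S) (tetrad i j k l)
      = MvPolynomial.C (S i j) * MvPolynomial.X (symIdx k l) + tetrad i j k l := by
    rw [shiftPoly_tetrad hS, hSkl, hSik, hSjl, tetrad, map_zero]
    ring
  have hlin : (MvPolynomial.C (S i j) * MvPolynomial.X (symIdx k l) :
      MvPolynomial (SymIdx m) ℝ) ≠ 0 :=
    mul_ne_zero (by simpa using hSij) (MvPolynomial.X_ne_zero _)
  have hzero := hcone _ (tetrad_mem_vanishingIdeal hij hkl hik hjl)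
  rw [hshift, initialForm_add_of_isHomogeneous (MvPolynomial.isHomogeneous_C_mul_X _ _)
    (tetrad_isHomogeneous i j k l) one_lt_two hlin, map_mul, MvPolynomial.eval_C,
    MvPolynomial.eval_X, symCoords_symIdx hX] at hzero
  exact (mul_eq_zero.mp hzero).resolve_left hSij

theorem tetrad_eq_zero_of_mem_algebraicTangentCone {i j k l : Fin m} (hS : S.IsSymm)
    (hX : X.IsSymm)
    (hcone : symCoords X ∈ algebraicTangentCone (symCoords '' factorModel m 1) (symCoords S))
    (hij : i ≠ j) (hkl : k ≠ l) (hik : i ≠ k) (hjl : j ≠ l)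
    (hSij : S i j = 0) (hSkl : S k l = 0) (hSik : S i k = 0) (hSjl : S j l = 0) :
    X i j * X k l = X i k * X j l := by
  by_cases hT : tetrad i j k l = 0
  · have := eval_tetrad_symCoords hX i j k l
    rw [hT, map_zero] at this
    linarith
  have hshift : shiftPoly (symCoords S) (tetrad i j k l) = tetrad i j k l := by
    rw [shiftPoly_tetrad hS, hSij, hSkl, hSik, hSjl, tetrad]
    simp only [map_zero, add_zero]
  have hzero := hcone _ (tetrad_mem_vanishingIdeal hij hkl hik hjl)
  rw [hshift, initialForm_of_isHomogeneous (tetrad_isHomogeneous _ _ _ _) hT,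
    eval_tetrad_symCoords hX] at hzero
  exact sub_eq_zero.mp hzero

variable {i j : Fin m}

theorem tangentEquations_of_mem_algebraicTangentCone (hS : S.IsSymm) (hX : X.IsSymm) (hij : i ≠ j)
    (hSij : S i j ≠ 0) (hpair : IsPairDiagonal i j S)
    (hcone : symCoords X ∈ algebraicTangentCone (symCoords '' factorModel m 1) (symCoords S)) :
    TangentEquations i j X where
  apply_eq_zero k l hkl := by
    have hkl' : (k : Fin m) ≠ l := Subtype.coe_ne_coe.mpr hkl
    exact linear_term_eq_zero_of_mem_algebraicTangentCone hS hX hcone hij hkl'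
      k.2.1.symm l.2.2.symm hSij (hpair.row_eq_zero k hkl'.symm)
      (hpair.col_eq_zero k k.2.1.symm) (hpair.col_eq_zero l l.2.2.symm)
  minor_eq k l := by
    have hSi (k : Others i j) : S i k = 0 := hpair.col_eq_zero k k.2.1.symm
    have hSj (k : Others i j) : S k j = 0 := hpair.row_eq_zero k k.2.2.symm
    have := tetrad_eq_zero_of_mem_algebraicTangentCone (i := i) (j := k) (k := l) (l := j) hS hX
      hcone k.2.1.symm l.2.2 l.2.1.symm k.2.2 (hSi k) (hSj l) (hSi l) (hSj k)
    rwa [hX.apply j l, hX.apply j k] at this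

end Tetrads

section FactorAnalysisCone

variable {m : ℕ} {S X : Matrix (Fin m) (Fin m) ℝ} {i j : Fin m}

theorem tendsto_symCoords_add_smul (X N : Matrix (Fin m) (Fin m) ℝ) :
    Tendsto (fun c : ℝ => symCoords (X + c • N)) (𝓝 0) (𝓝 (symCoords X)) := by
  have hcont : Continuous fun c : ℝ => symCoords (X + c • N) := continuous_pi fun p => by
    simp only [symCoords, Matrix.add_apply, Matrix.smul_apply]
    fun_prop
  simpa using hcont.tendsto 0

section RankOneRows

variable {a b : ℝ} {u : Fin m → ℝ} (hS : S.IsSymm) (hij : i ≠ j) (hpair : IsPairDiagonal i j S)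
  (hX : X.IsSymm) (hXoff : ∀ k l : Others i j, k ≠ l → X k l = 0) (ha : a ≠ 0) (hb : b ≠ 0)
  (hui : u i = 0) (huj : u j = 0) (hi : ∀ k : Others i j, X i k = a * u k)
  (hj : ∀ k : Others i j, X j k = b * u k)
include hS hij hpair hX hXoff ha hb hui huj hi hj

/-- The loading vector is `a` at `i`, `b` at `j`, and `(t a b / s) u` elsewhere, and it is scaled
by `p = s / (a b)`, where `s = S i j + t * X i j`. -/
theorem exists_loading_of_rows_eq {t : ℝ} (hst : S i j + t * X i j ≠ 0) :
    ∃ (γ : Fin m → ℝ) (p : ℝ), ∀ k l, k ≠ l →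
      (t • (X + (t * (a * b) / (S i j + t * X i j)) • Matrix.vecMulVec u u) + S) k l
        = p * (γ k * γ l) := by
  set s := S i j + t * X i j with hs
  let γ : Fin m → ℝ := Pi.single i a + Pi.single j b + (t * (a * b) / s) • u
  have hγi : γ i = a := by simp [γ, hij, hui]
  have hγj : γ j = b := by simp [γ, hij.symm, huj]
  have hγ (k : Others i j) : γ k = t * (a * b) / s * u k := by simp [γ, k.2.1, k.2.2]
  have hSi (k : Others i j) : S i k = 0 := hpair.col_eq_zero k k.2.1.symm
  have hSj (k : Others i j) : S j k = 0 := hpair.col_eq_zero k k.2.2.symm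
  refine ⟨γ, s / (a * b), forall_ne_of_forall_others (i := i) (j := j) (fun k l h => ?_) ?_
    (fun k => ?_) (fun k => ?_) fun k l hkl => ?_⟩
  all_goals simp only [Matrix.add_apply, Matrix.smul_apply, Matrix.vecMulVec_apply,
    smul_eq_mul] at *
  · rw [hX.apply k l, hS.apply k l, mul_comm (u l), h, mul_comm (γ k)]
  · rw [hγi, hγj, hui]; field_simp; rw [hs]; ring
  · rw [hγi, hγ, hui, hSi, hi]; field_simp; ring
  · rw [hγj, hγ, huj, hSj, hj]; field_simp; ring
  · rw [hγ, hγ, hXoff k l hkl, hpair.row_eq_zero k (Subtype.coe_ne_coe.mpr hkl.symm)]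
    field_simp
    ring

theorem mem_algebraicTangentCone_of_rows_eq (hSij : S i j ≠ 0) :
    symCoords X ∈ algebraicTangentCone (symCoords '' factorModel m 1) (symCoords S) := by
  have hs : Tendsto (fun t => S i j + t * X i j) (𝓝[>] 0) (𝓝 (S i j)) := by
    have : Continuous fun t => S i j + t * X i j := by fun_prop
    simpa using (this.tendsto 0).mono_left nhdsWithin_le_nhds
  have hcoef : Tendsto (fun t => t * (a * b) / (S i j + t * X i j)) (𝓝[>] 0) (𝓝 0) := by
    have hid : Tendsto (fun t : ℝ => t) (𝓝[>] 0) (𝓝 0) := nhdsWithin_le_nhds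
    have := (hid.mul_const (a * b)).div hs hSij
    rwa [zero_mul, zero_div] at this
  refine mem_algebraicTangentCone_of_tendsto
    ((tendsto_symCoords_add_smul X (Matrix.vecMulVec u u)).comp hcoef) fun f hf => ?_
  filter_upwards [hs.eventually_ne hSij] with t hst
  obtain ⟨γ, p, hγ⟩ := exists_loading_of_rows_eq hS hij hpair hX hXoff ha hb hui huj hi hj hst
  have hzero := eval_symCoords_eq_zero_of_apply_eq hf hγ
  exact hzero

end RankOneRows

theorem mem_algebraicTangentCone_of_tangentEquations (hS : S.IsSymm) (hij : i ≠ j)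
    (hSij : S i j ≠ 0) (hpair : IsPairDiagonal i j S) (hX : X.IsSymm)
    (h : TangentEquations i j X) :
    symCoords X ∈ algebraicTangentCone (symCoords '' factorModel m 1) (symCoords S) := by
  obtain ⟨a, b, v, -, hi, hj⟩ := exists_eq_smul_of_minors_eq h.minor_eq
  set u : Fin m → ℝ := Function.extend Subtype.val v 0
  have hu (k : Others i j) : u k = v k := Subtype.val_injective.extend_apply v 0 k
  have hui : u i = 0 := Function.extend_apply' _ _ _ fun ⟨k, hk⟩ => k.2.1 hk
  have huj : u j = 0 := Function.extend_apply' _ _ _ fun ⟨k, hk⟩ => k.2.2 hk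
  let e : Fin m → ℝ := Pi.single i 1 + Pi.single j 1
  have hei : e i = 1 := by simp [e, hij]
  have hej : e j = 1 := by simp [e, hij.symm]
  have he (k : Others i j) : e k = 0 := by simp [e, k.2.1, k.2.2]
  let Y (ε : ℝ) : Matrix (Fin m) (Fin m) ℝ :=
    X + ε • (Matrix.vecMulVec e u + Matrix.vecMulVec u e)
  have hlim : Tendsto (fun ε => symCoords (Y ε)) (𝓝[≠] 0) (𝓝 (symCoords X)) :=
    (tendsto_symCoords_add_smul X _).mono_left nhdsWithin_le_nhds
  have hne (c : ℝ) : ∀ᶠ ε in 𝓝[≠] (0 : ℝ), c + ε ≠ 0 :=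
    ((eventually_cofinite_ne (-c)).filter_mono (nhdsNE_le_cofinite 0)).mono fun ε hε h0 =>
      hε (by linarith)
  refine (isClosed_algebraicTangentCone _ _).mem_of_tendsto hlim ?_
  filter_upwards [hne a, hne b] with ε ha hb
  refine mem_algebraicTangentCone_of_rows_eq (u := u) hS hij hpair ?_ (fun k l hkl => ?_) ha hb
    hui huj (fun k => ?_) (fun k => ?_) hSij
  · refine hX.add (Matrix.IsSymm.smul ?_ ε)
    rw [Matrix.IsSymm, Matrix.transpose_add, Matrix.transpose_vecMulVec,
      Matrix.transpose_vecMulVec, add_comm]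
  · simp [Y, Matrix.vecMulVec_apply, he, h.apply_eq_zero k l hkl]
  · have : X i k = a * v k := congrFun hi k
    simp [Y, Matrix.vecMulVec_apply, he, hei, hu, this, add_mul]
  · have : X j k = b * v k := congrFun hj k
    simp [Y, Matrix.vecMulVec_apply, he, hej, hu, this, add_mul]

theorem mem_algebraicTangentCone_iff {τ : SymIdx m → ℝ} (hS : S.IsSymm) (hij : i ≠ j)
    (hSij : S i j ≠ 0) (hpair : IsPairDiagonal i j S) :
    τ ∈ algebraicTangentCone (symCoords '' factorModel m 1) (symCoords S)
      ↔ TangentEquations i j (symMatrix τ) := by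
  have hτ := symMatrix_isSymm τ
  conv_lhs => rw [← symCoords_symMatrix τ]
  exact ⟨tangentEquations_of_mem_algebraicTangentCone hS hτ hij hSij hpair,
    mem_algebraicTangentCone_of_tangentEquations hS hij hSij hpair hτ⟩

end FactorAnalysisCone

section Congruence

variable {n : Type*} [Fintype n] [DecidableEq n] {S X : Matrix n n ℝ}

theorem exists_commuting_whitening (hS : S.PosDef) :
    ∃ L M : Matrix n n ℝ, L * M = 1 ∧ M * L = 1 ∧ L * S * Lᵀ = 1 ∧
      ∀ A, Commute A S → Commute A L ∧ Commute A M := by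
  set M := CFC.sqrt S
  have hMM : M * M = S := CFC.sqrt_mul_sqrt_self S hS.posSemidef.nonneg
  have hMT : Mᵀ = M := by
    simpa only [Matrix.conjTranspose_eq_transpose_of_trivial] using
      (Matrix.nonneg_iff_posSemidef.mp (CFC.sqrt_nonneg S)).isHermitian.eq
  have hdet : IsUnit M.det := by
    refine isUnit_of_mul_isUnit_left (y := M.det) ?_
    rw [← Matrix.det_mul, hMM]
    exact hS.det_pos.ne'.isUnit
  have hLM : M⁻¹ * M = 1 := Matrix.nonsing_inv_mul M hdet
  have hML : M * M⁻¹ = 1 := Matrix.mul_nonsing_inv M hdet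
  refine ⟨M⁻¹, M, hLM, hML, ?_, fun A hA => ?_⟩
  · rw [Matrix.transpose_nonsing_inv, hMT, ← hMM, ← Matrix.mul_assoc, hLM, Matrix.one_mul, hML]
  · have hAM : A * M = M * A := hA.symm.cfcₙ_nnreal NNReal.sqrt |>.symm
    refine ⟨?_, hAM⟩
    calc A * M⁻¹ = M⁻¹ * (M * A) * M⁻¹ := by rw [← Matrix.mul_assoc, hLM, Matrix.one_mul]
      _ = M⁻¹ * A := by rw [← hAM, ← Matrix.mul_assoc, Matrix.mul_assoc, hML, Matrix.mul_one]

theorem exists_congr_one_diagonal (hS : S.PosDef) (hX : X.IsSymm) :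
    ∃ (C : Matrix n n ℝ) (lam : n → ℝ), C * S * Cᵀ = 1 ∧ C * X * Cᵀ = Matrix.diagonal lam := by
  obtain ⟨L, -, -, -, hL, -⟩ := exists_commuting_whitening hS
  have hherm : (L * X * Lᵀ).IsHermitian := by
    rw [Matrix.IsHermitian, Matrix.conjTranspose_eq_transpose_of_trivial, Matrix.transpose_mul,
      Matrix.transpose_mul, hX.eq, Matrix.transpose_transpose, Matrix.mul_assoc]
  set U : Matrix n n ℝ := (hherm.eigenvectorUnitary : Matrix n n ℝ)
  have hUU : Uᵀ * U = 1 := Matrix.mem_unitaryGroup_iff'.mp hherm.eigenvectorUnitary.2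
  have hdiag : Uᵀ * (L * X * Lᵀ) * U = Matrix.diagonal hherm.eigenvalues := calc
    Uᵀ * (L * X * Lᵀ) * U = Uᵀ * (U * Matrix.diagonal hherm.eigenvalues * Uᵀ) * U :=
      congrArg (Uᵀ * · * U) hherm.spectral_theorem
    _ = Uᵀ * U * Matrix.diagonal hherm.eigenvalues * (Uᵀ * U) := by simp only [Matrix.mul_assoc]
    _ = Matrix.diagonal hherm.eigenvalues := by rw [hUU, Matrix.one_mul, Matrix.mul_one]
  have hcongr (A : Matrix n n ℝ) : Uᵀ * L * A * (Uᵀ * L)ᵀ = Uᵀ * (L * A * Lᵀ) * U := by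
    rw [Matrix.transpose_mul, Matrix.transpose_transpose]
    simp only [Matrix.mul_assoc]
  refine ⟨Uᵀ * L, hherm.eigenvalues, ?_, ?_⟩
  · rw [hcongr, hL, Matrix.mul_one, hUU]
  · rw [hcongr, hdiag]

variable {C A : Matrix n n ℝ}

theorem inv_eq_of_congr_eq {D D' : Matrix n n ℝ} (h : C * A * Cᵀ = D) (hD : D * D' = 1) :
    A⁻¹ = Cᵀ * D' * C := by
  have hC : C * (A * Cᵀ * D') = 1 := by rw [← hD, ← h]; simp only [Matrix.mul_assoc]
  refine Matrix.inv_eq_right_inv ?_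
  calc A * (Cᵀ * D' * C) = A * Cᵀ * D' * C := by simp only [Matrix.mul_assoc]
    _ = 1 := mul_eq_one_comm.mp hC

theorem inv_eq_of_congr_eq_one (h : C * S * Cᵀ = 1) : S⁻¹ = Cᵀ * C := by
  simpa using inv_eq_of_congr_eq h (Matrix.mul_one 1)

theorem trace_inv_mul_of_congr_eq_one (h : C * S * Cᵀ = 1) (X : Matrix n n ℝ) :
    (S⁻¹ * X).trace = (C * X * Cᵀ).trace := by
  rw [inv_eq_of_congr_eq_one h, Matrix.mul_assoc, Matrix.trace_mul_comm]

theorem trace_inv_mul_mul_inv_mul_of_congr_eq_one (h : C * S * Cᵀ = 1) (X Y : Matrix n n ℝ) :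
    (S⁻¹ * X * S⁻¹ * Y).trace = (C * X * Cᵀ * (C * Y * Cᵀ)).trace := by
  rw [inv_eq_of_congr_eq_one h]
  calc (Cᵀ * C * X * (Cᵀ * C) * Y).trace = (Cᵀ * (C * X * Cᵀ * (C * Y))).trace := by
        simp only [Matrix.mul_assoc]
    _ = (C * X * Cᵀ * (C * Y * Cᵀ)).trace := by
        rw [Matrix.trace_mul_comm]
        simp only [Matrix.mul_assoc]

end Congruence

/-! ### Fisher information of the normal model -/

section GaussianMoments

theorem iteratedDeriv_exp_sq_div_two (n : ℕ) :
    iteratedDeriv n (fun t : ℝ => Real.exp (t ^ 2 / 2)) = fun t => Real.exp (t ^ 2 / 2) *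
      ((fun p : Polynomial ℝ => Polynomial.X * p + p.derivative)^[n] 1).eval t := by
  induction n with
  | zero => simp
  | succ n ih =>
    rw [iteratedDeriv_succ, ih, Function.iterate_succ_apply']
    set p : Polynomial ℝ := (fun p => Polynomial.X * p + p.derivative)^[n] 1
    funext t
    have hexp : HasDerivAt (fun t : ℝ => Real.exp (t ^ 2 / 2)) (Real.exp (t ^ 2 / 2) * t) t := by
      simpa using ((hasDerivAt_pow 2 t).div_const 2).exp
    rw [(hexp.fun_mul (p.hasDerivAt t)).deriv]
    simp only [Polynomial.eval_add, Polynomial.eval_mul, Polynomial.eval_X]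
    ring

theorem integral_pow_gaussianReal (n : ℕ) : ∫ x : ℝ, x ^ n ∂(gaussianReal 0 1) =
    ((fun p : Polynomial ℝ => Polynomial.X * p + p.derivative)^[n] 1).eval 0 := by
  have hmgf : mgf id (gaussianReal 0 1) = fun t => Real.exp (t ^ 2 / 2) := by
    simp [mgf_id_gaussianReal]
  have hmoment := iteratedDeriv_mgf_zero (X := id) (μ := gaussianReal 0 1)
    (by simp [integrableExpSet_id_gaussianReal]) n
  rw [hmgf, iteratedDeriv_exp_sq_div_two] at hmoment
  simpa using hmoment.symm

theorem integral_sq_gaussianReal : ∫ x : ℝ, x ^ 2 ∂(gaussianReal 0 1) = 1 := by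
  rw [integral_pow_gaussianReal]
  simp

theorem integral_pow_four_gaussianReal : ∫ x : ℝ, x ^ 4 ∂(gaussianReal 0 1) = 3 := by
  have hstep : (fun p : Polynomial ℝ => Polynomial.X * p + p.derivative)^[2] 1
      = Polynomial.X ^ 2 + 1 := by simp [sq]
  rw [integral_pow_gaussianReal, Function.iterate_add_apply _ 2 2, hstep]
  simp
  norm_num

theorem integrable_pow_gaussianReal (n : ℕ) :
    Integrable (fun x : ℝ => x ^ n) (gaussianReal 0 1) := by
  refine ((memLp_id_gaussianReal' (μ := 0) (v := 1) n
    (ENNReal.natCast_ne_top n)).integrable_norm_pow').mono' (by fun_prop) ?_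
  exact ae_of_all _ fun x => (norm_pow x n).le

theorem memLp_const_mul_sq_sub_one_gaussianReal (c : ℝ) :
    MemLp (fun x : ℝ => c * (x ^ 2 - 1)) 2 (gaussianReal 0 1) := by
  refine MemLp.const_mul (MemLp.sub ?_ (memLp_const 1)) c
  rw [memLp_two_iff_integrable_sq (by fun_prop)]
  simpa only [← pow_mul] using integrable_pow_gaussianReal 4

theorem integral_const_mul_sq_sub_one_gaussianReal (c : ℝ) :
    ∫ x : ℝ, c * (x ^ 2 - 1) ∂(gaussianReal 0 1) = 0 := by
  rw [integral_const_mul, integral_sub (integrable_pow_gaussianReal 2) (integrable_const _),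
    integral_sq_gaussianReal]
  simp

theorem variance_const_mul_sq_sub_one_gaussianReal (c : ℝ) :
    Var[fun x : ℝ => c * (x ^ 2 - 1); gaussianReal 0 1] = 2 * c ^ 2 := by
  have h2 := (integrable_pow_gaussianReal 2).const_mul 2
  have h4 := integrable_pow_gaussianReal 4
  have h42 : Integrable (fun x : ℝ => x ^ 4 - 2 * x ^ 2) (gaussianReal 0 1) := h4.sub h2
  rw [variance_of_integral_eq_zero (by fun_prop) (integral_const_mul_sq_sub_one_gaussianReal c)]
  calc ∫ x : ℝ, (c * (x ^ 2 - 1)) ^ 2 ∂(gaussianReal 0 1)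
      = ∫ x : ℝ, c ^ 2 * (x ^ 4 - 2 * x ^ 2 + 1) ∂(gaussianReal 0 1) := by
        congr with x
        ring
    _ = c ^ 2 * (3 - 2 * 1 + 1) := by
        rw [integral_const_mul, integral_add h42 (integrable_const _),
          integral_sub h4 h2, integral_const_mul, integral_sq_gaussianReal,
          integral_pow_four_gaussianReal]
        simp
    _ = 2 * c ^ 2 := by ring

section Pi

variable {ι : Type*} [Fintype ι]

theorem memLp_const_mul_eval_sq_sub_one_pi_gaussianReal (c : ℝ) (i : ι) :
    MemLp (fun y : ι → ℝ => c * (y i ^ 2 - 1)) 2 (Measure.pi fun _ => gaussianReal 0 1) :=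
  (memLp_const_mul_sq_sub_one_gaussianReal c).comp_measurePreserving
    (measurePreserving_eval (fun _ : ι => gaussianReal 0 1) i)

theorem memLp_sum_mul_sq_sub_one_pi_gaussianReal (c : ι → ℝ) :
    MemLp (fun y : ι → ℝ => ∑ i, c i * (y i ^ 2 - 1)) 2
      (Measure.pi fun _ => gaussianReal 0 1) :=
  memLp_finsetSum _ fun i _ => memLp_const_mul_eval_sq_sub_one_pi_gaussianReal (c i) i

theorem integral_sum_mul_sq_sub_one_pi_gaussianReal (c : ι → ℝ) :
    ∫ y : ι → ℝ, ∑ i, c i * (y i ^ 2 - 1) ∂(Measure.pi fun _ => gaussianReal 0 1) = 0 := by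
  rw [integral_finsetSum _ fun i _ =>
    (memLp_const_mul_eval_sq_sub_one_pi_gaussianReal (c i) i).integrable (by norm_num)]
  refine Finset.sum_eq_zero fun i _ => ?_
  rw [integral_comp_eval (μ := fun _ : ι => gaussianReal 0 1)
    (f := fun x : ℝ => c i * (x ^ 2 - 1)) (by fun_prop)]
  exact integral_const_mul_sq_sub_one_gaussianReal (c i)

theorem integral_sum_mul_sq_sub_one_sq_pi_gaussianReal (c : ι → ℝ) :
    ∫ y : ι → ℝ, (∑ i, c i * (y i ^ 2 - 1)) ^ 2 ∂(Measure.pi fun _ => gaussianReal 0 1)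
      = 2 * ∑ i, c i ^ 2 := by
  have hvar := variance_sum_pi (μ := fun _ : ι => gaussianReal 0 1)
    (X := fun i x => c i * (x ^ 2 - 1)) fun i => memLp_const_mul_sq_sub_one_gaussianReal (c i)
  rw [← variance_of_integral_eq_zero
    (memLp_sum_mul_sq_sub_one_pi_gaussianReal c).aestronglyMeasurable.aemeasurable
    (integral_sum_mul_sq_sub_one_pi_gaussianReal c), Finset.mul_sum]
  simpa only [variance_const_mul_sq_sub_one_gaussianReal, Finset.sum_fn] using hvar

end Pi

variable {ι κ : Type*} [Fintype ι] [Fintype κ] [DecidableEq ι] [DecidableEq κ]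

theorem map_toLp_mulVec_multivariateGaussian {S : Matrix ι ι ℝ} (hS : S.PosSemidef)
    {C : Matrix κ ι ℝ} (hC : C * S * Cᵀ = 1) :
    (multivariateGaussian 0 S).map (fun x => WithLp.toLp 2 (C *ᵥ x.ofLp))
      = stdGaussian (EuclideanSpace ℝ κ) := by
  refine Measure.ext_of_charFun (funext fun t => ?_)
  have hpull : charFun ((multivariateGaussian 0 S).map (fun x => WithLp.toLp 2 (C *ᵥ x.ofLp))) t
      = charFun (multivariateGaussian 0 S) (WithLp.toLp 2 (Cᵀ *ᵥ t.ofLp)) := by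
    rw [charFun_apply, charFun_apply, integral_map (by fun_prop) (by fun_prop)]
    simp only [EuclideanSpace.inner_eq_star_dotProduct, star_trivial, Matrix.mulVec_transpose,
      Matrix.dotProduct_mulVec]
  have hquad : (Cᵀ *ᵥ t.ofLp) ⬝ᵥ S *ᵥ (Cᵀ *ᵥ t.ofLp) = ‖t‖ ^ 2 := by
    rw [Matrix.mulVec_mulVec, Matrix.mulVec_transpose, ← Matrix.dotProduct_mulVec,
      Matrix.mulVec_mulVec, ← Matrix.mul_assoc, hC, Matrix.one_mulVec,
      EuclideanSpace.real_norm_sq_eq]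
    simp only [dotProduct, sq]
  rw [hpull, charFun_multivariateGaussian hS, charFun_stdGaussian, hquad]
  simp [neg_div]

theorem map_mulVec_multivariateGaussian {S : Matrix ι ι ℝ} (hS : S.PosSemidef)
    {C : Matrix κ ι ℝ} (hC : C * S * Cᵀ = 1) :
    (multivariateGaussian 0 S).map (fun x => C *ᵥ x.ofLp)
      = Measure.pi fun _ => gaussianReal 0 1 := by
  calc (multivariateGaussian 0 S).map (fun x => C *ᵥ x.ofLp)
      = ((multivariateGaussian 0 S).map fun x => WithLp.toLp 2 (C *ᵥ x.ofLp)).map WithLp.ofLp := by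
        rw [Measure.map_map (by fun_prop) (by fun_prop)]
        rfl
    _ = ((Measure.pi fun _ => gaussianReal 0 1).map (WithLp.toLp 2)).map WithLp.ofLp := by
        rw [map_toLp_mulVec_multivariateGaussian hS hC, map_pi_eq_stdGaussian]
    _ = Measure.pi fun _ => gaussianReal 0 1 := by
        rw [Measure.map_map (by fun_prop) (by fun_prop)]
        exact Measure.map_id

end GaussianMoments

section Fisher

variable {ι κ : Type*} [Fintype ι] [Fintype κ] [DecidableEq κ]

theorem dotProduct_congr_diagonal_mulVec (C : Matrix κ ι ℝ) (d : κ → ℝ) (x : ι → ℝ) :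
    x ⬝ᵥ (Cᵀ * Matrix.diagonal d * C) *ᵥ x = ∑ k, d k * (C *ᵥ x) k ^ 2 := by
  rw [Matrix.mul_assoc, ← Matrix.mulVec_mulVec, Matrix.dotProduct_mulVec, Matrix.vecMul_transpose,
    ← Matrix.mulVec_mulVec]
  simp only [dotProduct, Matrix.mulVec_diagonal]
  exact Finset.sum_congr rfl fun k _ => by ring

variable [DecidableEq ι]

/-- The derivative of the log-density of `N(0, S)` in the direction of a symmetric matrix, as a
function of the direction. -/
noncomputable def scoreForm (S : Matrix ι ι ℝ) (x : ι → ℝ) : Matrix ι ι ℝ →ₗ[ℝ] ℝ where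
  toFun X := (x ⬝ᵥ (S⁻¹ * X * S⁻¹) *ᵥ x - (S⁻¹ * X).trace) / 2
  map_add' X Y := by
    simp only [Matrix.mul_add, Matrix.add_mul, Matrix.add_mulVec, dotProduct_add,
      Matrix.trace_add]
    ring
  map_smul' c X := by
    simp only [Matrix.mul_smul, Matrix.smul_mul, Matrix.smul_mulVec, dotProduct_smul,
      Matrix.trace_smul, smul_eq_mul, RingHom.id_apply]
    ring

variable {S X Y C : Matrix ι ι ℝ} {lam : ι → ℝ}

theorem scoreForm_eq_of_congr (hS : C * S * Cᵀ = 1) (hX : C * X * Cᵀ = Matrix.diagonal lam)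
    (x : ι → ℝ) : scoreForm S x X = ∑ k, lam k / 2 * ((C *ᵥ x) k ^ 2 - 1) := by
  have hquad : S⁻¹ * X * S⁻¹ = Cᵀ * Matrix.diagonal lam * C := by
    rw [inv_eq_of_congr_eq_one hS, ← hX]
    simp only [Matrix.mul_assoc]
  change (x ⬝ᵥ (S⁻¹ * X * S⁻¹) *ᵥ x - (S⁻¹ * X).trace) / 2 = _
  rw [hquad, trace_inv_mul_of_congr_eq_one hS, hX, Matrix.trace_diagonal,
    dotProduct_congr_diagonal_mulVec, ← Finset.sum_sub_distrib, Finset.sum_div]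
  exact Finset.sum_congr rfl fun k _ => by ring

theorem measurePreserving_mulVec_multivariateGaussian (hS : S.PosDef) (hC : C * S * Cᵀ = 1) :
    MeasurePreserving (fun x : EuclideanSpace ℝ ι => C *ᵥ x.ofLp)
      (multivariateGaussian 0 S) (Measure.pi fun _ => gaussianReal 0 1) :=
  ⟨by fun_prop, map_mulVec_multivariateGaussian hS.posSemidef hC⟩

theorem memLp_scoreForm (hS : S.PosDef) (hX : X.IsSymm) :
    MemLp (fun x : EuclideanSpace ℝ ι => scoreForm S x.ofLp X) 2 (multivariateGaussian 0 S) := by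
  obtain ⟨C, lam, hCS, hCX⟩ := exists_congr_one_diagonal hS hX
  simp only [scoreForm_eq_of_congr hCS hCX]
  exact (memLp_sum_mul_sq_sub_one_pi_gaussianReal fun k => lam k / 2).comp_measurePreserving
    (measurePreserving_mulVec_multivariateGaussian hS hCS)

theorem integral_scoreForm_sq (hS : S.PosDef) (hX : X.IsSymm) :
    ∫ x : EuclideanSpace ℝ ι, scoreForm S x.ofLp X ^ 2 ∂(multivariateGaussian 0 S)
      = (S⁻¹ * X * S⁻¹ * X).trace / 2 := by
  obtain ⟨C, lam, hCS, hCX⟩ := exists_congr_one_diagonal hS hX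
  have hC := measurePreserving_mulVec_multivariateGaussian hS hCS
  have hmeas : AEStronglyMeasurable (fun y : ι → ℝ => (∑ k, lam k / 2 * (y k ^ 2 - 1)) ^ 2)
      ((multivariateGaussian 0 S).map fun x => C *ᵥ x.ofLp) :=
    Continuous.aestronglyMeasurable (by fun_prop)
  simp only [scoreForm_eq_of_congr hCS hCX]
  rw [← integral_map hC.measurable.aemeasurable hmeas, hC.map_eq,
    integral_sum_mul_sq_sub_one_sq_pi_gaussianReal,
    trace_inv_mul_mul_inv_mul_of_congr_eq_one hCS, hCX, Matrix.diagonal_mul_diagonal,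
    Matrix.trace_diagonal, Finset.mul_sum, Finset.sum_div]
  exact Finset.sum_congr rfl fun k _ => by ring

theorem integral_scoreForm_mul (hS : S.PosDef) (hX : X.IsSymm) (hY : Y.IsSymm) :
    ∫ x : EuclideanSpace ℝ ι, scoreForm S x.ofLp X * scoreForm S x.ofLp Y
      ∂(multivariateGaussian 0 S) = (S⁻¹ * X * S⁻¹ * Y).trace / 2 := by
  have hXX := (memLp_scoreForm hS hX).integrable_sq
  have hYY := (memLp_scoreForm hS hY).integrable_sq
  have hXY : Integrable (fun x : EuclideanSpace ℝ ι =>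
      2 * (scoreForm S x.ofLp X * scoreForm S x.ofLp Y)) (multivariateGaussian 0 S) :=
    ((memLp_scoreForm hS hX).integrable_mul (memLp_scoreForm hS hY)).const_mul 2
  have hXXY : Integrable (fun x : EuclideanSpace ℝ ι => scoreForm S x.ofLp X ^ 2 +
      2 * (scoreForm S x.ofLp X * scoreForm S x.ofLp Y)) (multivariateGaussian 0 S) := hXX.add hXY
  have hcomm : (S⁻¹ * Y * S⁻¹ * X).trace = (S⁻¹ * X * S⁻¹ * Y).trace := by
    rw [Matrix.mul_assoc (S⁻¹ * Y), Matrix.trace_mul_comm, ← Matrix.mul_assoc]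
  have hsum := integral_scoreForm_sq hS (hX.add hY)
  simp only [map_add, add_sq, mul_assoc (2 : ℝ)] at hsum
  rw [integral_add hXXY hYY, integral_add hXX hXY, integral_const_mul,
    integral_scoreForm_sq hS hX, integral_scoreForm_sq hS hY] at hsum
  simp only [Matrix.mul_add, Matrix.add_mul, Matrix.trace_add, hcomm] at hsum
  linarith

variable {m : ℕ}

theorem log_normalDensity_of_congr {A C : Matrix (Fin m) (Fin m) ℝ} {e : Fin m → ℝ}
    (h : C * A * Cᵀ = Matrix.diagonal e) (he : ∀ k, 0 < e k) (x : Fin m → ℝ) :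
    Real.log (normalDensity A x) =
      -(Real.log ((2 * Real.pi) ^ m / C.det ^ 2) + ∑ k, Real.log (e k)) / 2
        - (∑ k, (e k)⁻¹ * (C *ᵥ x) k ^ 2) / 2 := by
  have hprod : 0 < ∏ k, e k := Finset.prod_pos fun k _ => he k
  have hdet : C.det ^ 2 * A.det = ∏ k, e k := by
    rw [← Matrix.det_diagonal, ← h, Matrix.det_mul, Matrix.det_mul, Matrix.det_transpose]
    ring
  have hC : C.det ≠ 0 := by
    rintro h0
    simp [h0, hprod.ne] at hdet
  have hAdet : (2 * Real.pi) ^ m * A.det = (2 * Real.pi) ^ m / C.det ^ 2 * ∏ k, e k := by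
    rw [← hdet]
    field_simp
  have hAinv : A⁻¹ = Cᵀ * Matrix.diagonal (fun k => (e k)⁻¹) * C := by
    refine inv_eq_of_congr_eq h ?_
    rw [Matrix.diagonal_mul_diagonal, ← Matrix.diagonal_one]
    exact congrArg _ (funext fun k => mul_inv_cancel₀ (he k).ne')
  rw [normalDensity, hAdet, hAinv, dotProduct_congr_diagonal_mulVec,
    Real.log_mul (by positivity) (by positivity), Real.log_exp, Real.log_inv,
    Real.log_sqrt (by positivity), Real.log_mul (by positivity) hprod.ne',
    Real.log_prod fun k _ => (he k).ne']
  ring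

theorem hasDerivAt_log_normalDensity {S X : Matrix (Fin m) (Fin m) ℝ} (hS : S.PosDef)
    (hX : X.IsSymm) (x : Fin m → ℝ) :
    HasDerivAt (fun t : ℝ => Real.log (normalDensity (S + t • X) x)) (scoreForm S x X) 0 := by
  obtain ⟨C, lam, hCS, hCX⟩ := exists_congr_one_diagonal hS hX
  have hcongr (t : ℝ) : C * (S + t • X) * Cᵀ = Matrix.diagonal fun k => 1 + t * lam k := by
    rw [Matrix.mul_add, Matrix.add_mul, hCS, Matrix.mul_smul, Matrix.smul_mul, hCX,
      ← Matrix.diagonal_one, ← Matrix.diagonal_smul, Matrix.diagonal_add]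
    rfl
  have hpos : ∀ᶠ t : ℝ in 𝓝 0, ∀ k, 0 < 1 + t * lam k := by
    refine eventually_all.mpr fun k => ?_
    have hcont : Continuous fun t : ℝ => 1 + t * lam k := by fun_prop
    exact hcont.continuousAt.eventually_const_lt (by simp)
  have hlin (k : Fin m) : HasDerivAt (fun t : ℝ => 1 + t * lam k) (lam k) 0 := by
    simpa using ((hasDerivAt_id' (0 : ℝ)).mul_const (lam k)).const_add 1
  have hlog : HasDerivAt (fun t : ℝ => ∑ k, Real.log (1 + t * lam k)) (∑ k, lam k) 0 := by
    simpa using HasDerivAt.fun_sum fun k (_ : k ∈ Finset.univ) => (hlin k).log (by simp)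
  have hinv : HasDerivAt (fun t : ℝ => ∑ k, (1 + t * lam k)⁻¹ * (C *ᵥ x) k ^ 2)
      (∑ k, -lam k * (C *ᵥ x) k ^ 2) 0 := by
    simpa using HasDerivAt.fun_sum fun k (_ : k ∈ Finset.univ) =>
      ((hlin k).fun_inv (by simp)).mul_const ((C *ᵥ x) k ^ 2)
  refine HasDerivAt.congr_of_eventuallyEq ?_
    (hpos.mono fun t ht => log_normalDensity_of_congr (hcongr t) ht x)
  refine (((hlog.const_add _).fun_neg.div_const 2).fun_sub (hinv.div_const 2)).congr_deriv ?_
  rw [scoreForm_eq_of_congr hCS hCX, ← Finset.sum_neg_distrib, Finset.sum_div, Finset.sum_div,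
    ← Finset.sum_sub_distrib]
  exact Finset.sum_congr rfl fun k _ => by ring

theorem normalScore_eq_scoreForm {S : Matrix (Fin m) (Fin m) ℝ} (hS : S.PosDef) (a : SymIdx m)
    (x : Fin m → ℝ) : normalScore S a x = scoreForm S x (symMatrix (Pi.single a 1)) := by
  have hsymm : S.IsSymm := hS.isHermitian
  simp only [normalScore, symMatrix_add, symMatrix_smul, symMatrix_symCoords hsymm]
  exact (hasDerivAt_log_normalDensity hS (symMatrix_isSymm _) x).deriv

theorem fisherInformation_apply {S : Matrix (Fin m) (Fin m) ℝ} (hS : S.PosDef) (a b : SymIdx m) :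
    fisherInformation S a b =
      (S⁻¹ * symMatrix (Pi.single a 1) * S⁻¹ * symMatrix (Pi.single b 1)).trace / 2 := by
  simp only [fisherInformation, Matrix.of_apply, normalScore_eq_scoreForm hS]
  exact integral_scoreForm_mul hS (symMatrix_isSymm _) (symMatrix_isSymm _)

end Fisher

/-! ### Whitened coordinates -/

section Whitening

section StandardForm

variable {κ : Type*} [Fintype κ]

theorem mahalanobisForm_transpose_mul_self (T : Matrix κ κ ℝ) (z τ : κ → ℝ) :
    mahalanobisForm (Tᵀ * T) z τ = ∑ p, ((T *ᵥ z) p - (T *ᵥ τ) p) ^ 2 := by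
  rw [mahalanobisForm, ← Matrix.mulVec_mulVec, Matrix.dotProduct_mulVec, Matrix.vecMul_transpose,
    Matrix.mulVec_sub]
  simp only [dotProduct, Pi.sub_apply, sq]

variable [DecidableEq κ]

theorem map_mulVec_multivariateGaussian_inv {T : Matrix κ κ ℝ} (hT : IsUnit T) :
    (multivariateGaussian 0 (Tᵀ * T)⁻¹).map (fun z => T *ᵥ z.ofLp)
      = Measure.pi fun _ => gaussianReal 0 1 := by
  have hdet : IsUnit T.det := (Matrix.isUnit_iff_isUnit_det T).mp hT
  refine map_mulVec_multivariateGaussian ?_ ?_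
  · have hpos := Matrix.posSemidef_conjTranspose_mul_self T
    rw [Matrix.conjTranspose_eq_transpose_of_trivial] at hpos
    exact hpos.inv
  · rw [Matrix.mul_inv_rev, ← Matrix.mul_assoc, Matrix.mul_nonsing_inv T hdet, Matrix.one_mul,
      Matrix.nonsing_inv_mul Tᵀ (by rwa [Matrix.det_transpose])]

end StandardForm

variable {m : ℕ}

/-- The scaling of the upper triangular entries under which half the squared Frobenius norm of a
symmetric matrix becomes the squared Euclidean norm. -/
noncomputable def frobWeight (p : SymIdx m) : ℝ := if p.1.1 = p.1.2 then (√2)⁻¹ else 1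

theorem frobWeight_ne_zero (p : SymIdx m) : frobWeight p ≠ 0 := by
  rw [frobWeight]
  split_ifs <;> positivity

theorem sum_sum_div_two_eq_sum_symIdx {F : Fin m → Fin m → ℝ} (hF : ∀ a b, F a b = F b a) :
    (∑ a, ∑ b, F a b) / 2 = ∑ p : SymIdx m, frobWeight p ^ 2 * F p.1.1 p.1.2 := by
  have hfiber (p : SymIdx m) : Finset.univ.filter (fun q : Fin m × Fin m => symIdx q.1 q.2 = p)
      = {p.1, p.1.swap} := by
    ext ⟨a, b⟩
    simp only [Finset.mem_filter, Finset.mem_univ, true_and, Finset.mem_insert,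
      Finset.mem_singleton, Prod.ext_iff, Prod.fst_swap, Prod.snd_swap]
    rw [← symIdx_eq_iff, symIdx_of_le p.2]
  rw [← Fintype.sum_prod_type' F, ← Finset.sum_fiberwise (g := fun q => symIdx q.1 q.2),
    Finset.sum_div]
  refine Finset.sum_congr rfl fun p _ => ?_
  rw [hfiber, frobWeight]
  split_ifs with hp
  · rw [show p.1.swap = p.1 from Prod.ext hp.symm hp, Finset.pair_eq_singleton,
      Finset.sum_singleton, inv_pow, Real.sq_sqrt zero_le_two]
    ring
  · rw [Finset.sum_pair fun h => hp (congrArg Prod.fst h), Prod.fst_swap, Prod.snd_swap,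
      hF p.1.2]
    ring

/-- The scaled upper triangular entries of `L X Lᵗ`, where `X` is the symmetric matrix with the
given coordinates. -/
noncomputable def whiten (L : Matrix (Fin m) (Fin m) ℝ) :
    (SymIdx m → ℝ) →ₗ[ℝ] (SymIdx m → ℝ) where
  toFun v p := frobWeight p * (L * symMatrix v * Lᵀ) p.1.1 p.1.2
  map_add' v w := by
    funext p
    simp only [symMatrix_add, mul_add, Matrix.add_mul, Matrix.add_apply, Pi.add_apply]
  map_smul' c v := by
    funext p
    simp only [symMatrix_smul, Matrix.mul_smul, Matrix.smul_mul, Matrix.smul_apply,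
      Pi.smul_apply, RingHom.id_apply, smul_eq_mul, mul_left_comm]

theorem whiten_apply (L : Matrix (Fin m) (Fin m) ℝ) (v : SymIdx m → ℝ) (p : SymIdx m) :
    whiten L v p = frobWeight p * (L * symMatrix v * Lᵀ) p.1.1 p.1.2 := rfl

theorem isSymm_mul_symMatrix_mul_transpose (L : Matrix (Fin m) (Fin m) ℝ) (v : SymIdx m → ℝ) :
    (L * symMatrix v * Lᵀ).IsSymm := by
  rw [Matrix.IsSymm, Matrix.transpose_mul, Matrix.transpose_mul, (symMatrix_isSymm v).eq,
    Matrix.transpose_transpose, Matrix.mul_assoc]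

theorem whiten_symIdx (L : Matrix (Fin m) (Fin m) ℝ) (v : SymIdx m → ℝ) {a b : Fin m}
    (hab : a ≠ b) : whiten L v (symIdx a b) = (L * symMatrix v * Lᵀ) a b := by
  have hweight : frobWeight (symIdx a b) = 1 := if_neg (by simpa [symIdx] using hab)
  rw [whiten_apply, hweight, one_mul]
  exact symCoords_symIdx (isSymm_mul_symMatrix_mul_transpose L v) a b

variable {S L M : Matrix (Fin m) (Fin m) ℝ}

theorem whiten_surjective (hLM : L * M = 1) : Function.Surjective (whiten L) := by
  intro y
  set u : SymIdx m → ℝ := fun p => (frobWeight p)⁻¹ * y p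
  refine ⟨symCoords (M * symMatrix u * Mᵀ), funext fun p => ?_⟩
  have hu : L * (M * symMatrix u * Mᵀ) * Lᵀ = symMatrix u := calc
    L * (M * symMatrix u * Mᵀ) * Lᵀ = L * M * symMatrix u * (L * M)ᵀ := by
      simp only [Matrix.transpose_mul, Matrix.mul_assoc]
    _ = symMatrix u := by rw [hLM, Matrix.one_mul, Matrix.transpose_one, Matrix.mul_one]
  rw [whiten_apply, symMatrix_symCoords (isSymm_mul_symMatrix_mul_transpose M u), hu,
    show symMatrix u p.1.1 p.1.2 = u p from congrFun (symCoords_symMatrix u) p]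
  exact mul_inv_cancel_left₀ (frobWeight_ne_zero p) (y p)

theorem sum_whiten_mul_whiten (L : Matrix (Fin m) (Fin m) ℝ) (v w : SymIdx m → ℝ) :
    ∑ p, whiten L v p * whiten L w p
      = (L * symMatrix v * Lᵀ * (L * symMatrix w * Lᵀ)).trace / 2 := by
  have hv := isSymm_mul_symMatrix_mul_transpose L v
  have hw := isSymm_mul_symMatrix_mul_transpose L w
  have htrace := sum_sum_div_two_eq_sum_symIdx
    (F := fun a b => (L * symMatrix v * Lᵀ) a b * (L * symMatrix w * Lᵀ) a b)
    fun a b => by rw [hv.apply a b, hw.apply a b]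
  calc ∑ p, whiten L v p * whiten L w p
      = ∑ p : SymIdx m, frobWeight p ^ 2 *
          ((L * symMatrix v * Lᵀ) p.1.1 p.1.2 * (L * symMatrix w * Lᵀ) p.1.1 p.1.2) := by
        simp only [whiten_apply]
        exact Finset.sum_congr rfl fun p _ => by ring
    _ = (L * symMatrix v * Lᵀ * (L * symMatrix w * Lᵀ)ᵀ).trace / 2 := by
        rw [← htrace]
        simp only [Matrix.trace, Matrix.diag, Matrix.mul_apply, Matrix.transpose_apply]
    _ = (L * symMatrix v * Lᵀ * (L * symMatrix w * Lᵀ)).trace / 2 := by rw [hw.eq]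

theorem fisherInformation_eq_transpose_mul_self (hS : S.PosDef) (hL : L * S * Lᵀ = 1) :
    fisherInformation S = (LinearMap.toMatrix' (whiten L))ᵀ * LinearMap.toMatrix' (whiten L) := by
  ext a b
  simp only [fisherInformation_apply hS, trace_inv_mul_mul_inv_mul_of_congr_eq_one hL,
    Matrix.mul_apply, Matrix.transpose_apply, LinearMap.toMatrix'_apply, ← sum_whiten_mul_whiten]

theorem mahalanobisForm_fisherInformation (hS : S.PosDef) (hL : L * S * Lᵀ = 1)
    (z τ : SymIdx m → ℝ) :
    mahalanobisForm (fisherInformation S) z τ = ∑ p, (whiten L z p - whiten L τ p) ^ 2 := by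
  rw [fisherInformation_eq_transpose_mul_self hS hL, mahalanobisForm_transpose_mul_self]
  simp only [LinearMap.toMatrix'_mulVec]

theorem map_whiten_multivariateGaussian (hS : S.PosDef) (hLM : L * M = 1) (hL : L * S * Lᵀ = 1) :
    (multivariateGaussian 0 (fisherInformation S)⁻¹).map (fun z => whiten L z.ofLp)
      = Measure.pi fun _ => gaussianReal 0 1 := by
  have hunit : IsUnit (LinearMap.toMatrix' (whiten L)) := by
    rw [← Matrix.mulVec_surjective_iff_isUnit]
    intro y
    obtain ⟨v, rfl⟩ := whiten_surjective hLM y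
    exact ⟨v, LinearMap.toMatrix'_mulVec _ _⟩
  rw [fisherInformation_eq_transpose_mul_self hS hL, ← map_mulVec_multivariateGaussian_inv hunit]
  simp only [LinearMap.toMatrix'_mulVec]

end Whitening

/-! ### Distance to the tangent cone -/

section SmallestEigenvalue

variable {p : ℕ} [NeZero p] {M : Matrix (Fin p) (Fin p) ℝ}

theorem isLeast_smallestEigenvalue (hM : M.IsHermitian) :
    IsLeast {c | Module.End.HasEigenvalue (Matrix.toLin' M) c} (smallestEigenvalue M) := by
  have hrange : {c | Module.End.HasEigenvalue (Matrix.toLin' M) c}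
      = Set.range hM.eigenvalues := by
    rw [← hM.spectrum_real_eq_range_eigenvalues, ← Matrix.spectrum_toLin']
    exact Set.ext fun c => Module.End.hasEigenvalue_iff_mem_spectrum
  have hfinite := Set.finite_range hM.eigenvalues
  rw [smallestEigenvalue, hrange]
  exact ⟨(Set.range_nonempty _).csInf_mem hfinite, fun c hc => csInf_le hfinite.bddBelow hc⟩

theorem exists_mulVec_eq_smallestEigenvalue_smul (hM : M.IsHermitian) :
    ∃ w : Fin p → ℝ, w ⬝ᵥ w = 1 ∧ M *ᵥ w = smallestEigenvalue M • w := by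
  obtain ⟨v, hv, hv0⟩ := (isLeast_smallestEigenvalue hM).1.exists_hasEigenvector
  rw [Module.End.mem_eigenspace_iff, Matrix.toLin'_apply] at hv
  have hpos : 0 < v ⬝ᵥ v := Matrix.dotProduct_star_self_pos_iff.mpr hv0
  refine ⟨(√(v ⬝ᵥ v))⁻¹ • v, ?_, by rw [Matrix.mulVec_smul, hv, smul_comm]⟩
  rw [smul_dotProduct, dotProduct_smul, smul_smul, smul_eq_mul, ← mul_inv,
    Real.mul_self_sqrt hpos.le, inv_mul_cancel₀ hpos.ne']

theorem smallestEigenvalue_mul_dotProduct_le (hM : M.IsHermitian) (w : Fin p → ℝ) :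
    smallestEigenvalue M * (w ⬝ᵥ w) ≤ w ⬝ᵥ M *ᵥ w := by
  have hle : algebraMap ℝ (Matrix (Fin p) (Fin p) ℝ) (smallestEigenvalue M) ≤ M := by
    refine algebraMap_le_of_le_spectrum (fun c hc => ?_) hM
    rw [← Matrix.spectrum_toLin', ← Module.End.hasEigenvalue_iff_mem_spectrum] at hc
    exact (isLeast_smallestEigenvalue hM).2 hc
  have hnonneg := (Matrix.le_iff.mp hle).dotProduct_mulVec_nonneg w
  rw [Algebra.algebraMap_eq_smul_one, Matrix.sub_mulVec, Matrix.smul_mulVec, Matrix.one_mulVec,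
    star_trivial, dotProduct_sub, dotProduct_smul, smul_eq_mul] at hnonneg
  exact sub_nonneg.mp hnonneg

end SmallestEigenvalue

section LowRankApproximation

variable {κ : Type*} {p : ℕ}

theorem forall_minor_eq_iff_exists_mulVec_eq_zero {Y : Matrix κ (Fin 2) ℝ} :
    (∀ k l, Y k 0 * Y l 1 = Y l 0 * Y k 1) ↔ ∃ w : Fin 2 → ℝ, w ≠ 0 ∧ Y *ᵥ w = 0 := by
  have hmulVec (w : Fin 2 → ℝ) : Y *ᵥ w = 0 ↔ ∀ k, Y k 0 * w 0 + Y k 1 * w 1 = 0 := by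
    simp only [funext_iff, Matrix.mulVec, dotProduct, Fin.sum_univ_two, Pi.zero_apply]
  constructor
  · intro h
    obtain ⟨a, b, u, hab, hx, hy⟩ :=
      exists_eq_smul_of_minors_eq (x := fun k => Y k 0) (y := fun k => Y k 1) h
    refine ⟨![b, -a], fun hw => ?_, (hmulVec _).mpr fun k => ?_⟩
    · have hb : b = 0 := congrFun hw 0
      have ha : a = 0 := neg_eq_zero.mp (congrFun hw 1)
      exact hab.elim (· ha) (· hb)
    · rw [congrFun hx k, congrFun hy k]
      simp only [Pi.smul_apply, smul_eq_mul, Matrix.cons_val_zero, Matrix.cons_val_one]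
      ring
  · rintro ⟨w, hw, hYw⟩ k l
    rw [hmulVec] at hYw
    by_contra hne
    have h0 : w 0 = 0 := (mul_eq_zero.mp
      (by linear_combination Y l 1 * hYw k - Y k 1 * hYw l :
        (Y k 0 * Y l 1 - Y l 0 * Y k 1) * w 0 = 0)).resolve_left (sub_ne_zero.mpr hne)
    have h1 : w 1 = 0 := (mul_eq_zero.mp
      (by linear_combination Y k 0 * hYw l - Y l 0 * hYw k :
        (Y k 0 * Y l 1 - Y l 0 * Y k 1) * w 1 = 0)).resolve_left (sub_ne_zero.mpr hne)
    exact hw (funext (Fin.forall_fin_two.mpr ⟨h0, h1⟩))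

variable [Fintype κ]

theorem isHermitian_transpose_mul_self (Y : Matrix κ (Fin p) ℝ) : (Yᵀ * Y).IsHermitian :=
  Matrix.conjTranspose_eq_transpose_of_trivial Y ▸ Matrix.isHermitian_conjTranspose_mul_self Y

theorem dotProduct_transpose_mul_self_mulVec (Y : Matrix κ (Fin p) ℝ) (w : Fin p → ℝ) :
    w ⬝ᵥ (Yᵀ * Y) *ᵥ w = ∑ k, (Y *ᵥ w) k ^ 2 := by
  rw [← Matrix.mulVec_mulVec, Matrix.dotProduct_mulVec, Matrix.vecMul_transpose]
  simp only [dotProduct, sq]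

theorem smallestEigenvalue_le_sum_sq_sub_of_mulVec_eq_zero [NeZero p] (Y : Matrix κ (Fin p) ℝ)
    {Y' : Matrix κ (Fin p) ℝ} {w : Fin p → ℝ} (hw : w ≠ 0) (hY' : Y' *ᵥ w = 0) :
    smallestEigenvalue (Yᵀ * Y) ≤ ∑ k, ∑ c, (Y k c - Y' k c) ^ 2 := by
  refine le_of_mul_le_mul_right ?_ (Matrix.dotProduct_star_self_pos_iff.mpr hw)
  calc smallestEigenvalue (Yᵀ * Y) * (w ⬝ᵥ w)
      ≤ w ⬝ᵥ (Yᵀ * Y) *ᵥ w :=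
        smallestEigenvalue_mul_dotProduct_le (isHermitian_transpose_mul_self Y) w
    _ = ∑ k, ((Y - Y') *ᵥ w) k ^ 2 := by
        rw [dotProduct_transpose_mul_self_mulVec, Matrix.sub_mulVec, hY', sub_zero]
    _ ≤ ∑ k, (∑ c, (Y k c - Y' k c) ^ 2) * ∑ c, w c ^ 2 :=
        Finset.sum_le_sum fun k _ =>
          Finset.sum_mul_sq_le_sq_mul_sq Finset.univ (fun c => Y k c - Y' k c) w
    _ = (∑ k, ∑ c, (Y k c - Y' k c) ^ 2) * (w ⬝ᵥ w) := by
        rw [← Finset.sum_mul]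
        simp only [dotProduct, sq]

theorem exists_mulVec_eq_zero_sum_sq_sub_eq_smallestEigenvalue [NeZero p]
    (Y : Matrix κ (Fin p) ℝ) :
    ∃ (Y' : Matrix κ (Fin p) ℝ) (w : Fin p → ℝ), w ≠ 0 ∧ Y' *ᵥ w = 0 ∧
      ∑ k, ∑ c, (Y k c - Y' k c) ^ 2 = smallestEigenvalue (Yᵀ * Y) := by
  obtain ⟨w, hw, hYw⟩ :=
    exists_mulVec_eq_smallestEigenvalue_smul (isHermitian_transpose_mul_self Y)
  refine ⟨Y - Matrix.vecMulVec (Y *ᵥ w) w, w, ?_, ?_, ?_⟩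
  · rintro rfl
    simp at hw
  · rw [Matrix.sub_mulVec, Matrix.vecMulVec_mulVec, hw, MulOpposite.op_one, one_smul, sub_self]
  · calc ∑ k, ∑ c, (Y k c - (Y - Matrix.vecMulVec (Y *ᵥ w) w) k c) ^ 2
        = ∑ k, (Y *ᵥ w) k ^ 2 * (w ⬝ᵥ w) := by
          simp only [Matrix.sub_apply, sub_sub_cancel, Matrix.vecMulVec_apply, dotProduct,
            Finset.mul_sum, sq, mul_mul_mul_comm]
      _ = w ⬝ᵥ (Yᵀ * Y) *ᵥ w := by
          simp only [hw, mul_one, dotProduct_transpose_mul_self_mulVec]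
      _ = smallestEigenvalue (Yᵀ * Y) := by
          rw [hYw, dotProduct_smul, hw, smul_eq_mul, mul_one]

theorem isLeast_sum_sq_sub_minors_eq (Y : Matrix κ (Fin 2) ℝ) :
    IsLeast ((fun Y' : Matrix κ (Fin 2) ℝ => ∑ k, ∑ c, (Y k c - Y' k c) ^ 2) ''
      {Y' | ∀ k l, Y' k 0 * Y' l 1 = Y' l 0 * Y' k 1}) (smallestEigenvalue (Yᵀ * Y)) := by
  simp only [forall_minor_eq_iff_exists_mulVec_eq_zero]
  constructor
  · obtain ⟨Y', w, hw, hY', hsum⟩ := exists_mulVec_eq_zero_sum_sq_sub_eq_smallestEigenvalue Y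
    exact ⟨Y', ⟨w, hw, hY'⟩, hsum⟩
  · rintro _ ⟨Y', ⟨w, hw, hY'⟩, rfl⟩
    exact smallestEigenvalue_le_sum_sq_sub_of_mulVec_eq_zero Y hw hY'

end LowRankApproximation

section RankOneCone

variable {α κ σ : Type*}

/-- The cone of pairs consisting of the zero vector and a two-column matrix whose `2 × 2` minors
vanish, the shape that the tangent cone takes in whitened coordinates. -/
def rankOneCone (α κ : Type*) : Set (α ⊕ κ × Fin 2 → ℝ) :=
  {v | (∀ p, v (.inl p) = 0) ∧
    ∀ k l, v (.inr (k, 0)) * v (.inr (l, 1)) = v (.inr (l, 0)) * v (.inr (k, 1))}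

/-- The Gram matrix `YᵗY` of the matrix `Y` with the given entries. -/
def gramOfEntries [Fintype κ] {p : ℕ} (g : κ × Fin p → ℝ) : Matrix (Fin p) (Fin p) ℝ :=
  (Matrix.of (Function.curry g))ᵀ * Matrix.of (Function.curry g)

/-- The closed form of the squared Euclidean distance to `rankOneCone`. -/
noncomputable def rankOneDistSq [Fintype α] [Fintype κ] (u : α ⊕ κ × Fin 2 → ℝ) : ℝ :=
  ∑ p, u (.inl p) ^ 2 + smallestEigenvalue (gramOfEntries (u ∘ .inr))

theorem sum_sq_sub_eq_of_mem_rankOneCone [Fintype α] [Fintype κ] (u : α ⊕ κ × Fin 2 → ℝ)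
    {v : α ⊕ κ × Fin 2 → ℝ} (hv : v ∈ rankOneCone α κ) :
    ∑ q, (u q - v q) ^ 2
      = ∑ p, u (.inl p) ^ 2 + ∑ k, ∑ c, (u (.inr (k, c)) - v (.inr (k, c))) ^ 2 := by
  simp only [Fintype.sum_sum_type, Fintype.sum_prod_type, hv.1, sub_zero]

theorem isLeast_rankOneDistSq [Fintype α] [Fintype κ] (u : α ⊕ κ × Fin 2 → ℝ) :
    IsLeast ((fun v => ∑ q, (u q - v q) ^ 2) '' rankOneCone α κ) (rankOneDistSq u) := by
  obtain ⟨⟨Y, hY, hsum⟩, hlower⟩ := isLeast_sum_sq_sub_minors_eq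
    (Matrix.of (Function.curry (u ∘ .inr)))
  constructor
  · have hmem : Sum.elim (fun _ => 0) (fun q => Y q.1 q.2) ∈ rankOneCone α κ := ⟨fun _ => rfl, hY⟩
    refine ⟨_, hmem, ?_⟩
    rw [rankOneDistSq, gramOfEntries, ← hsum]
    exact sum_sq_sub_eq_of_mem_rankOneCone u hmem
  · rintro _ ⟨v, hv, rfl⟩
    simp only [sum_sq_sub_eq_of_mem_rankOneCone u hv]
    exact add_le_add_right (hlower ⟨Matrix.of (Function.curry (v ∘ .inr)), hv.2, rfl⟩) _

theorem isLeast_sum_sq_sub_of_comp_injective [Fintype α] [Fintype σ] {e : α → σ}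
    (he : Function.Injective e) {B : Set (α → ℝ)} (y : σ → ℝ) {r : ℝ}
    (h : IsLeast ((fun b => ∑ q, (y (e q) - b q) ^ 2) '' B) r) :
    IsLeast ((fun y' => ∑ p, (y p - y' p) ^ 2) '' {y' | y' ∘ e ∈ B}) r := by
  constructor
  · obtain ⟨b, hb, rfl⟩ := h.1
    have hextend : Function.extend e b y ∘ e = b := funext fun q => he.extend_apply b y q
    refine ⟨Function.extend e b y, by rwa [Set.mem_ofPred_eq, hextend], Eq.symm ?_⟩
    refine Fintype.sum_of_injective e he _ _ (fun p hp => ?_) fun q => ?_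
    · rw [Function.extend_apply' b y p hp, sub_self, zero_pow two_ne_zero]
    · rw [he.extend_apply]
  · rintro _ ⟨y', hy', rfl⟩
    calc r ≤ ∑ q, (y (e q) - y' (e q)) ^ 2 := h.2 ⟨_, hy', rfl⟩
      _ = ∑ p ∈ Finset.univ.map ⟨e, he⟩, (y p - y' p) ^ 2 := by
          rw [Finset.sum_map]
          rfl
      _ ≤ ∑ p, (y p - y' p) ^ 2 := Finset.sum_le_univ_sum_of_nonneg fun p => sq_nonneg _

end RankOneCone

section WhitenedCone

variable {m : ℕ} {i j : Fin m}

/-- The coordinates constrained by the tangent cone: the off-diagonal entries outside the rows and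
columns `i`, `j`, and the entries of the rows `i` and `j` outside the columns `i`, `j`. -/
def coneIndex (i j : Fin m) :
    {p : Others i j × Others i j // p.1 < p.2} ⊕ Others i j × Fin 2 → SymIdx m :=
  Sum.elim (fun p => symIdx p.1.1 p.1.2) fun q => symIdx (![i, j] q.2) q.1

theorem Others.ne_pair (k : Others i j) (c : Fin 2) : k.1 ≠ ![i, j] c := by
  fin_cases c
  exacts [k.2.1, k.2.2]

theorem coneIndex_injective (hij : i ≠ j) : Function.Injective (coneIndex i j) := by
  have hpair : Function.Injective ![i, j] := by
    simpa [Function.Injective, Fin.forall_fin_two] using ⟨hij, hij.symm⟩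
  rintro (⟨⟨a, b⟩, hab⟩ | ⟨a, c⟩) (⟨⟨a', b'⟩, hab'⟩ | ⟨a', c'⟩) h <;>
    rcases symIdx_eq_iff.mp h with ⟨h₁, h₂⟩ | ⟨h₁, h₂⟩
  · cases Subtype.ext h₁
    cases Subtype.ext h₂
    rfl
  · cases Subtype.ext h₁
    cases Subtype.ext h₂
    exact absurd hab (lt_asymm hab')
  · exact absurd h₁ (a.ne_pair c')
  · exact absurd h₂ (b.ne_pair c')
  · exact absurd h₁.symm (a'.ne_pair c)
  · exact absurd h₁.symm (b'.ne_pair c)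
  · cases hpair h₁
    cases Subtype.ext h₂
    rfl
  · exact absurd h₂ (a.ne_pair c')

theorem comp_coneIndex_mem_rankOneCone_iff {y : SymIdx m → ℝ} :
    y ∘ coneIndex i j ∈ rankOneCone _ (Others i j) ↔
      (∀ k l : Others i j, k ≠ l → y (symIdx k l) = 0) ∧
        ∀ k l : Others i j,
          y (symIdx i k) * y (symIdx j l) = y (symIdx i l) * y (symIdx j k) := by
  refine and_congr ⟨fun h k l hkl => ?_, fun h p => h _ _ p.2.ne⟩ Iff.rfl
  rcases lt_or_gt_of_ne hkl with hlt | hgt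
  · exact h ⟨(k, l), hlt⟩
  · rw [symIdx_comm]
    exact h ⟨(l, k), hgt⟩

theorem whiten_comp_coneIndex_mem_rankOneCone_iff (L : Matrix (Fin m) (Fin m) ℝ)
    (v : SymIdx m → ℝ) :
    whiten L v ∘ coneIndex i j ∈ rankOneCone _ (Others i j) ↔
      TangentEquations i j (L * symMatrix v * Lᵀ) := by
  have hoff (k l : Others i j) (hkl : k ≠ l) :
      whiten L v (symIdx k l) = (L * symMatrix v * Lᵀ) k l :=
    whiten_symIdx L v (Subtype.coe_ne_coe.mpr hkl)
  have hrow_i (k : Others i j) : whiten L v (symIdx i k) = (L * symMatrix v * Lᵀ) i k :=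
    whiten_symIdx L v k.2.1.symm
  have hrow_j (k : Others i j) : whiten L v (symIdx j k) = (L * symMatrix v * Lᵀ) j k :=
    whiten_symIdx L v k.2.2.symm
  rw [comp_coneIndex_mem_rankOneCone_iff]
  simp only [hrow_i, hrow_j]
  exact ⟨fun h => ⟨fun k l hkl => hoff k l hkl ▸ h.1 k l hkl, h.2⟩,
    fun h => ⟨fun k l hkl => (hoff k l hkl).trans (h.apply_eq_zero k l hkl), h.minor_eq⟩⟩

theorem exists_linearMap_isLeast_mahalanobisForm {S : Matrix (Fin m) (Fin m) ℝ}
    (hS : S.PosDef) (hij : i ≠ j) (hSij : S i j ≠ 0) (hpair : IsPairDiagonal i j S) :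
    ∃ T : (SymIdx m → ℝ) →ₗ[ℝ] (SymIdx m → ℝ),
      HasLaw (fun z : EuclideanSpace ℝ (SymIdx m) => T z.ofLp)
          (Measure.pi fun _ => gaussianReal 0 1)
          (multivariateGaussian 0 (fisherInformation S)⁻¹) ∧
        ∀ z, IsLeast (mahalanobisForm (fisherInformation S) z ''
            algebraicTangentCone (symCoords '' factorModel m 1) (symCoords S))
          (rankOneDistSq (T z ∘ coneIndex i j)) := by
  obtain ⟨L, M, hLM, hML, hL, hcomm⟩ := exists_commuting_whitening hS
  have hmeas : Measurable fun z : EuclideanSpace ℝ (SymIdx m) => whiten L z.ofLp :=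
    ((LinearMap.continuous_of_finiteDimensional (whiten L)).comp
      (PiLp.continuous_ofLp 2 _)).measurable
  refine ⟨whiten L, ⟨hmeas.aemeasurable, map_whiten_multivariateGaussian hS hLM hL⟩, fun z => ?_⟩
  have hsymm : S.IsSymm := hS.isHermitian
  have hcone : algebraicTangentCone (symCoords '' factorModel m 1) (symCoords S)
      = whiten L ⁻¹' {y | y ∘ coneIndex i j ∈ rankOneCone _ (Others i j)} := by
    ext τ
    rw [mem_algebraicTangentCone_iff hsymm hij hSij hpair, Set.mem_preimage,
      Set.mem_ofPred_eq, whiten_comp_coneIndex_mem_rankOneCone_iff,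
      tangentEquations_mul_mul_transpose_iff hij hML (fun k => (hcomm _ (hpair k)).1)
        fun k => (hcomm _ (hpair k)).2]
  have hform : mahalanobisForm (fisherInformation S) z
      = (fun y => ∑ p, (whiten L z p - y p) ^ 2) ∘ whiten L :=
    funext fun τ => mahalanobisForm_fisherInformation hS hL z τ
  rw [hcone, hform, Set.image_comp, Set.image_preimage_eq _ (whiten_surjective hLM)]
  exact isLeast_sum_sq_sub_of_comp_injective (coneIndex_injective hij) _
    (isLeast_rankOneDistSq (whiten L z ∘ coneIndex i j))

end WhitenedCone

/-! ### Laws of the two parts -/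

section ProductLaws

variable {ι κ : Type*} [Fintype ι] [Fintype κ]

theorem pi_map_comp_injective {E : Type*} [MeasurableSpace E] (ν : Measure E)
    [IsProbabilityMeasure ν] {φ : ι → κ} (hφ : Function.Injective φ) :
    (Measure.pi fun _ : κ => ν).map (fun y => y ∘ φ) = Measure.pi fun _ : ι => ν := by
  rw [← Measure.infinitePi_eq_pi, ← Measure.infinitePi_eq_pi]
  exact Measure.map_infinitePi_infinitePi_of_inj (P := fun _ : κ => ν) hφ

theorem indepFun_comp_inl_comp_inr_pi {E : Type*} [MeasurableSpace E] (ν : Measure E)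
    [IsProbabilityMeasure ν] :
    IndepFun (fun y : ι ⊕ κ → E => y ∘ Sum.inl) (fun y : ι ⊕ κ → E => y ∘ Sum.inr)
      (Measure.pi fun _ => ν) := by
  rw [indepFun_iff_map_prod_eq_prod_map_map (Measurable.aemeasurable (by fun_prop))
      (Measurable.aemeasurable (by fun_prop)),
    pi_map_comp_injective ν Sum.inl_injective, pi_map_comp_injective ν Sum.inr_injective]
  exact (measurePreserving_sumPiEquivProdPi fun _ : ι ⊕ κ => ν).map_eq

theorem map_sum_sq_pi_gaussianReal :
    (Measure.pi fun _ : ι => gaussianReal 0 1).map (fun x => ∑ i, x i ^ 2)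
      = chiSquareLaw (Fintype.card ι) := by
  let e := (Fintype.equivFin ι).symm
  rw [chiSquareLaw, ← pi_map_comp_injective (gaussianReal 0 1) e.injective,
    Measure.map_map (by fun_prop) (by fun_prop)]
  exact congrArg (Measure.map · _) (funext fun x => (e.sum_comp fun i => x i ^ 2).symm)

theorem measurable_gramOfEntries {p : ℕ} :
    Measurable (gramOfEntries : (κ × Fin p → ℝ) → Matrix (Fin p) (Fin p) ℝ) := by
  refine measurable_pi_lambda _ fun a => measurable_pi_lambda _ fun b => ?_
  simp only [gramOfEntries, Matrix.mul_apply, Matrix.transpose_apply, Matrix.of_apply,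
    Function.curry_apply]
  fun_prop

theorem map_toLp_curry_pi_gaussianReal {n p : ℕ} :
    (Measure.pi fun _ : Fin n × Fin p => gaussianReal 0 1).map
        (fun g k => WithLp.toLp 2 (Function.curry g k))
      = Measure.pi fun _ => multivariateGaussian (0 : EuclideanSpace ℝ (Fin p)) 1 := by
  have hcurry := Measure.infinitePi_map_curry fun (_ : Fin n) (_ : Fin p) => gaussianReal 0 1
  simp only [Measure.infinitePi_eq_pi] at hcurry
  rw [multivariateGaussian_zero_one, ← map_pi_eq_stdGaussian,
    ← Measure.pi_map_pi (fun _ => by fun_prop), ← hcurry,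
    Measure.map_map (by fun_prop) (by fun_prop)]
  rfl

theorem map_gramOfEntries_pi_gaussianReal {p : ℕ} :
    (Measure.pi fun _ : κ × Fin p => gaussianReal 0 1).map gramOfEntries
      = wishartLaw p (Fintype.card κ) 1 := by
  let e := (Fintype.equivFin κ).symm
  have hgram (g : κ × Fin p → ℝ) :
      gramOfEntries g = ∑ k, Matrix.vecMulVec (fun c => g (e k, c)) fun c => g (e k, c) := by
    ext a b
    simp only [gramOfEntries, Matrix.mul_apply, Matrix.sum_apply, Matrix.vecMulVec_apply]
    exact (e.sum_comp fun k => g (k, a) * g (k, b)).symm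
  have hmeas : Measurable fun x : Fin (Fintype.card κ) → EuclideanSpace ℝ (Fin p) =>
      ∑ k, Matrix.vecMulVec (x k).ofLp (x k).ofLp := by
    refine measurable_pi_lambda _ fun a => measurable_pi_lambda _ fun b => ?_
    simp only [Matrix.sum_apply, Matrix.vecMulVec_apply]
    fun_prop
  rw [wishartLaw, ← map_toLp_curry_pi_gaussianReal, Measure.map_map hmeas (by fun_prop),
    ← pi_map_comp_injective (gaussianReal 0 1) (e.injective.prodMap Function.injective_id),
    Measure.map_map (hmeas.comp (by fun_prop)) (by fun_prop)]
  exact congrArg (Measure.map · _) (funext hgram)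

theorem identDistrib_comp_of_hasLaw {Ω E β : Type*} [MeasurableSpace Ω] [MeasurableSpace E]
    [MeasurableSpace β] {P : Measure Ω} {μ : Measure E} {X : Ω → E} (hX : HasLaw X μ P) {f : E → β}
    (hf : AEMeasurable f μ) : IdentDistrib (fun ω => f (X ω)) f P μ :=
  (hX.identDistrib HasLaw.id).comp_of_aemeasurable (by rwa [hX.map_eq])

theorem identDistrib_comp_of_injective {E β : Type*} [MeasurableSpace E] [MeasurableSpace β]
    {ν : Measure E} [IsProbabilityMeasure ν] {φ : ι → κ} (hφ : Function.Injective φ)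
    {f : (ι → E) → β} (hf : AEMeasurable f (Measure.pi fun _ => ν)) :
    IdentDistrib (fun y : κ → E => f (y ∘ φ)) f (Measure.pi fun _ => ν)
      (Measure.pi fun _ => ν) := by
  have hφm : Measurable fun y : κ → E => y ∘ φ := by fun_prop
  exact identDistrib_comp_of_hasLaw ⟨hφm.aemeasurable, pi_map_comp_injective ν hφ⟩ hf

theorem identDistrib_comp_inl_add_comp_inr {E Ω : Type*} [MeasurableSpace E] [MeasurableSpace Ω]
    {ν : Measure E} [IsProbabilityMeasure ν] {Q : Measure Ω} {V W : Ω → ℝ} {f : (ι → E) → ℝ}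
    {g : (κ → E) → ℝ} (hf : IdentDistrib f V (Measure.pi fun _ => ν) Q)
    (hg : IdentDistrib g W (Measure.pi fun _ => ν) Q) (hVW : IndepFun V W Q) :
    IdentDistrib (fun u : ι ⊕ κ → E => f (u ∘ Sum.inl) + g (u ∘ Sum.inr))
      (fun ω => V ω + W ω) (Measure.pi fun _ => ν) Q := by
  have hinl := (identDistrib_comp_of_injective (κ := ι ⊕ κ) Sum.inl_injective
    hf.aemeasurable_fst).trans hf
  have hinr := (identDistrib_comp_of_injective (κ := ι ⊕ κ) Sum.inr_injective
    hg.aemeasurable_fst).trans hg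
  have hindep : IndepFun (fun u : ι ⊕ κ → E => f (u ∘ Sum.inl))
      (fun u : ι ⊕ κ → E => g (u ∘ Sum.inr)) (Measure.pi fun _ => ν) := by
    refine (indepFun_comp_inl_comp_inr_pi ν).comp₀ (φ := f) (ψ := g)
      (Measurable.aemeasurable (by fun_prop)) (Measurable.aemeasurable (by fun_prop)) ?_ ?_
    · rw [pi_map_comp_injective ν Sum.inl_injective]
      exact hf.aemeasurable_fst
    · rw [pi_map_comp_injective ν Sum.inr_injective]
      exact hg.aemeasurable_fst
  exact (hinl.prodMk hinr hindep hVW).comp (u := fun q : ℝ × ℝ => q.1 + q.2) (by fun_prop)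

theorem identDistrib_rankOneDistSq {Ω : Type*} [MeasurableSpace Ω] {Q : Measure Ω} {V W : Ω → ℝ}
    (hV : HasLaw V (chiSquareLaw (Fintype.card ι)) Q)
    (hW : IdentDistrib W smallestEigenvalue Q (wishartLaw 2 (Fintype.card κ) 1))
    (hVW : IndepFun V W Q) :
    IdentDistrib (rankOneDistSq : (ι ⊕ κ × Fin 2 → ℝ) → ℝ) (fun ω => V ω + W ω)
      (Measure.pi fun _ => gaussianReal 0 1) Q := by
  have hsq : HasLaw (fun x : ι → ℝ => ∑ p, x p ^ 2) (chiSquareLaw (Fintype.card ι))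
      (Measure.pi fun _ => gaussianReal 0 1) :=
    ⟨Measurable.aemeasurable (by fun_prop), map_sum_sq_pi_gaussianReal⟩
  have hgram : HasLaw (gramOfEntries : (κ × Fin 2 → ℝ) → _) (wishartLaw 2 (Fintype.card κ) 1)
      (Measure.pi fun _ => gaussianReal 0 1) :=
    ⟨measurable_gramOfEntries.aemeasurable, map_gramOfEntries_pi_gaussianReal⟩
  have heigen := identDistrib_comp_of_hasLaw hgram hW.aemeasurable_snd
  exact identDistrib_comp_inl_add_comp_inr (hsq.identDistrib hV) (heigen.trans hW.symm) hVW

end ProductLaws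

theorem card_ordered_pairs (α : Type*) [Fintype α] [LinearOrder α] :
    Fintype.card {p : α × α // p.1 < p.2} = (Fintype.card α).choose 2 := by
  rw [← Sym2.card_subtype_not_diag, Fintype.card_subtype, Fintype.card_subtype,
    Finset.card_eq_sum_ones, Finset.card_eq_sum_ones, ← Finset.sym2_univ,
    Finset.sum_sym2_filter_not_isDiag]
  refine Finset.sum_congr (Finset.ext fun p => ?_) fun _ _ => rfl
  simpa using fun h => h.ne

theorem card_others {n : Type*} [Fintype n] [DecidableEq n] {i j : n} (hij : i ≠ j) :
    Fintype.card (Others i j) = Fintype.card n - 2 := by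
  have hcompl : (Finset.univ.filter fun k => k ≠ i ∧ k ≠ j) = ({i, j} : Finset n)ᶜ := by
    ext k
    simp
  rw [Fintype.card_subtype, hcompl, Finset.card_compl, Finset.card_pair hij]

theorem exists_isPairDiagonal_of_existsUnique {m : ℕ} {S : Matrix (Fin m) (Fin m) ℝ}
    (hS : S.IsSymm) (hone : ∃! p : Fin m × Fin m, p.1 < p.2 ∧ S p.1 p.2 ≠ 0) :
    ∃ i j, i ≠ j ∧ S i j ≠ 0 ∧ IsPairDiagonal i j S := by
  obtain ⟨⟨i, j⟩, ⟨hlt, hSij⟩, huniq⟩ := hone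
  refine ⟨i, j, hlt.ne, hSij, isPairDiagonal_iff.mpr fun k a hak => ?_⟩
  suffices h : S k a = 0 from ⟨h, (hS.apply k a).trans h⟩
  by_contra hne
  rcases lt_or_gt_of_ne hak with h | h
  · exact k.2.2 (congrArg Prod.snd (huniq (a, k) ⟨h, (hS.apply k a).trans_ne hne⟩))
  · exact k.2.1 (congrArg Prod.fst (huniq (k, a) ⟨h, hne⟩))

theorem theorem6p3 (m : ℕ) (hm : 4 ≤ m)
    (S₀ : Matrix (Fin m) (Fin m) ℝ) (hS₀ : S₀ ∈ factorModel m 1)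
    (hone : ∃! p : Fin m × Fin m, p.1 < p.2 ∧ S₀ p.1 p.2 ≠ 0)
    {Ω : Type*} [MeasurableSpace Ω] (P : Measure Ω) [IsProbabilityMeasure P]
    (Z : Ω → EuclideanSpace ℝ (SymIdx m))
    (hZ : HasLaw Z (multivariateGaussian 0 (fisherInformation S₀)⁻¹) P)
    {Ω' : Type*} [MeasurableSpace Ω'] (Q : Measure Ω') [IsProbabilityMeasure Q]
    (V W : Ω' → ℝ)
    (hV : HasLaw V (chiSquareLaw ((m - 2).choose 2)) Q)
    (hW : IdentDistrib W smallestEigenvalue Q (wishartLaw 2 (m - 2) 1))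
    (hVW : IndepFun V W Q) :
    (∀ z : SymIdx m → ℝ,
      IsLeast
        (mahalanobisForm (fisherInformation S₀) z ''
          algebraicTangentCone (symCoords '' factorModel m 1) (symCoords S₀))
        (mahalanobisDistSq (fisherInformation S₀)
          (algebraicTangentCone (symCoords '' factorModel m 1) (symCoords S₀)) z)) ∧
    IdentDistrib
      (fun ω => mahalanobisDistSq (fisherInformation S₀)
        (algebraicTangentCone (symCoords '' factorModel m 1) (symCoords S₀)) (Z ω).ofLp)
      (fun ω => V ω + W ω) P Q := by
  obtain ⟨i, j, hij, hSij, hpair⟩ :=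
    exists_isPairDiagonal_of_existsUnique (isSymm_of_mem_factorModel hS₀) hone
  obtain ⟨T, hT, hleast⟩ :=
    exists_linearMap_isLeast_mahalanobisForm (posDef_of_mem_factorModel hS₀) hij hSij hpair
  have hdist (z : SymIdx m → ℝ) : mahalanobisDistSq (fisherInformation S₀)
      (algebraicTangentCone (symCoords '' factorModel m 1) (symCoords S₀)) z
        = rankOneDistSq (T z ∘ coneIndex i j) := (hleast z).csInf_eq
  simp only [hdist]
  refine ⟨hleast, ?_⟩
  have hothers : Fintype.card (Others i j) = m - 2 := by rw [card_others hij, Fintype.card_fin]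
  rw [← hothers] at hV hW
  rw [← card_ordered_pairs] at hV
  have hsum := identDistrib_rankOneDistSq hV hW hVW
  have hcomp := identDistrib_comp_of_injective (coneIndex_injective hij) hsum.aemeasurable_fst
  exact (identDistrib_comp_of_hasLaw (hT.fun_comp hZ) hcomp.aemeasurable_fst).trans
    (hcomp.trans hsum)
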